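/- Let $G=(V,E)$ be a finite simple undirected graph with a threshold function $t:V\to\mathbb{Z}_{\ge 0}$. Starting from an initial set $S\subseteq V$ of active vertices, in every round each vertex $v$ that has at least $t(v)$ active neighbours becomes active (active vertices stay active). The set $S$ is a \emph{target set} if eventually all vertices of $G$ are active, and a \emph{minimal target set} if it is inclusionwise minimal among target sets. \textbf{Corollary.} Let $c\ge 0$ be a constant. There are an algorithm and a polynomial $p$, both depending only on $c$, such that for every $G$ and every $t$ with $t(v)\le c$ for all $v\in V$ the algorithm, given $(G,t)$, outputs all minimal target sets of $G$ one by one, without repetition, and halts, with polynomial delay: the computing time before the first output, between any two consecutive outputs, and from the last output until halting is at most $p(N)$, where $N$ is the size of the input. Here $V=\{0,\dots,n-1\}$, the input is the list consisting of $n$, the adjacency matrix of $G$ and the values of $t$, so $N=n^2+n+1$, and each minimal target set is output as its characteristic vector. Time is the number of steps of a random access machine whose unit-cost steps are: setting a register to a constant, copying a register, adding or subtracting $1$, comparing two registers ($=$, $<$), reading or writing a memory cell whose address is in a register, writing a symbol to the output, and ending an output. -/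

import Mathlib

/-! ### Target sets -/

namespace TargetSet

variable {V : Type*} [Fintype V]

open Classical in
/-- The set of active vertices after a given number of rounds of the activation process started
from `S`: in every round each vertex `v` having at least `t v` active neighbours becomes active,
and active vertices stay active. -/
noncomputable def active (G : SimpleGraph V) (t : V → ℕ) (S : Finset V) : ℕ → Finset V
  | 0 => S
  | k + 1 => active G t S k ∪
      Finset.univ.filter fun v => t v ≤ ((active G t S k).filter fun u => G.Adj v u).card

/-- `S` is a target set: the activation started from `S` spreads to the entire graph. -/
def IsTargetSet (G : SimpleGraph V) (t : V → ℕ) (S : Finset V) : Prop :=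
  ∃ k, active G t S k = Finset.univ

/-- `S` is an inclusionwise minimal target set. -/
def IsMinimalTargetSet (G : SimpleGraph V) (t : V → ℕ) (S : Finset V) : Prop :=
  Minimal (IsTargetSet G t) S

end TargetSet

/-! ### Random access machines with an output device

Unit-cost random access machines.  A program uses finitely many registers and finitely many
memory banks (those whose numbers occur in the program text); every memory bank is an infinite
array of cells addressed by natural numbers.  The only arithmetic is adding or subtracting one, so
that after `T` steps no stored number exceeds the largest number in the input or in the program by
more than `T`; therefore charging one unit per step is a realistic measure of time.
-/

namespace RAM

/-- Configurations of a machine. -/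
structure State where
  /-- contents of the registers -/
  reg : ℕ → ℕ
  /-- `mem b a` is the content of the cell of memory bank `b` with address `a` -/
  mem : ℕ → ℕ → ℕ
  /-- the symbols written since the last completed output (or since the start) -/
  buf : List ℕ
  /-- the completed outputs in order, each with the time of its completion -/
  out : List (List ℕ × ℕ)
  /-- the number of steps performed so far -/
  time : ℕ

/-- The initial configuration on input `x`: the entries of `x` are in the first cells of memory
bank `0`, and all other cells and all registers are zero. -/
def State.initial (x : List ℕ) : State where
  reg := fun _ => 0
  mem := fun b a => if b = 0 then x.getD a 0 else 0
  buf := []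
  out := []
  time := 0

/-- One unit of time passes. -/
def State.tick (s : State) : State := { s with time := s.time + 1 }

/-- Assign the value `v` to register `r`. -/
def State.setReg (s : State) (r v : ℕ) : State := { s with reg := Function.update s.reg r v }

/-- Write the value `v` to the cell with address `a` in memory bank `b`. -/
def State.setMem (s : State) (b a v : ℕ) : State :=
  { s with mem := Function.update s.mem b (Function.update (s.mem b) a v) }

/-- Elementary instructions.  The arguments are register numbers `r`, `r'`, memory bank numbers
`b` and constants `k`. -/
inductive Instr where
  /-- `r := k` -/
  | const (r k : ℕ)
  /-- `r := r'` -/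
  | copy (r r' : ℕ)
  /-- `r := r + 1` -/
  | incr (r : ℕ)
  /-- `r := r - 1` (and `0` stays `0`) -/
  | decr (r : ℕ)
  /-- `r := mem b [r']` -/
  | load (r b r' : ℕ)
  /-- `mem b [r] := r'` -/
  | store (b r r' : ℕ)
  /-- write the content of `r` as the next symbol of the current output -/
  | write (r : ℕ)
  /-- complete the current output -/
  | emit

/-- The effect of an elementary instruction; each takes one unit of time. -/
def Instr.run : Instr → State → State
  | const r k, s => (s.setReg r k).tick
  | copy r r', s => (s.setReg r (s.reg r')).tick
  | incr r, s => (s.setReg r (s.reg r + 1)).tick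
  | decr r, s => (s.setReg r (s.reg r - 1)).tick
  | load r b r', s => (s.setReg r (s.mem b (s.reg r'))).tick
  | store b r r', s => (s.setMem b (s.reg r) (s.reg r')).tick
  | write r, s => { s with buf := s.buf ++ [s.reg r], time := s.time + 1 }
  | emit, s => { s with buf := [], out := s.out ++ [(s.buf, s.time + 1)], time := s.time + 1 }

/-- Tests comparing two registers. -/
inductive Test where
  | eq (r r' : ℕ)
  | lt (r r' : ℕ)

/-- The outcome of a test. -/
def Test.Holds : Test → State → Prop
  | eq r r', s => s.reg r = s.reg r'
  | lt r r', s => s.reg r < s.reg r'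

/-- Programs. -/
inductive Prog where
  | skip
  | basic (i : Instr)
  | seq (P Q : Prog)
  | ite (b : Test) (P Q : Prog)
  | loop (b : Test) (P : Prog)

/-- `Exec P s s'`: started in configuration `s`, the program `P` halts in configuration `s'`.
Every elementary instruction and every evaluation of a test takes one unit of time;
`loop b P` is `while b do P`. -/
inductive Exec : Prog → State → State → Prop where
  | skip (s : State) : Exec .skip s s
  | basic (i : Instr) (s : State) : Exec (.basic i) s (i.run s)
  | seq {P Q : Prog} {s s' s'' : State} :
      Exec P s s' → Exec Q s' s'' → Exec (.seq P Q) s s''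
  | iteTrue {b : Test} {P Q : Prog} {s s' : State} :
      b.Holds s → Exec P s.tick s' → Exec (.ite b P Q) s s'
  | iteFalse {b : Test} {P Q : Prog} {s s' : State} :
      ¬ b.Holds s → Exec Q s.tick s' → Exec (.ite b P Q) s s'
  | loopTrue {b : Test} {P : Prog} {s s' s'' : State} :
      b.Holds s → Exec P s.tick s' → Exec (.loop b P) s' s'' → Exec (.loop b P) s s''
  | loopFalse {b : Test} {P : Prog} {s : State} :
      ¬ b.Holds s → Exec (.loop b P) s s.tick

/-- On input `x`, the program `P` outputs exactly the members of `W`, one by one and without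
repetition, and halts; the time until the first output, the time between any two consecutive
outputs, and the time from the last output until halting are all at most `d`. -/
def GeneratesWithDelay (P : Prog) (x : List ℕ) (W : Set (List ℕ)) (d : ℕ) : Prop :=
  ∃ s : State, Exec P (State.initial x) s ∧
    (s.out.map Prod.fst).Nodup ∧
    (∀ w, w ∈ s.out.map Prod.fst ↔ w ∈ W) ∧
    List.IsChain (fun T T' => T' ≤ T + d) (0 :: (s.out.map Prod.snd ++ [s.time]))

end RAM

/-! ### Encoding of instances and outputs -/

namespace TargetSet

open Classical in
/-- The encoding of a graph with thresholds on the vertices `0, …, n - 1`: the number `n`, followed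
by the adjacency matrix row by row, followed by the thresholds. -/
noncomputable def encodeInstance {n : ℕ} (G : SimpleGraph (Fin n)) (t : Fin n → ℕ) : List ℕ :=
  n :: ((List.ofFn fun k : Fin (n * n) => if G.Adj k.divNat k.modNat then 1 else 0) ++ List.ofFn t)

/-- The characteristic vector of a set of vertices. -/
def charVector {n : ℕ} (S : Finset (Fin n)) : List ℕ :=
  List.ofFn fun v => if v ∈ S then 1 else 0

end TargetSet

namespace RAM

/-! ### Structured programs with bounded loops -/

/-! The enumeration is a search in a directed graph on the minimal target sets. From S there is an
arc for every vertex v and every set K of at most c vertices such that (S ∪ K) \ {v} is a target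
set; it leads to one minimal target set contained in that set. There are polynomially many arcs out
of S for fixed c, and each is computed in polynomial time by greedy shrinking.

Every minimal target set T is reachable from every S (`mem_of_exchange_closed`). If S ⊄ T, pick v in
S \ T. In the activation from T, v has t(v) ≤ c neighbours K that become active strictly earlier
(`IsTargetSet.exists_rank`), and (S ∪ K) \ {v} is again a target set (`IsTargetSet.exchange`), since
K activates v. Give weight 0 to the vertices of T and (c + 1) ^ rank to the others. Each vertex of K
weighs at most w(v) / (c + 1), so K weighs less than v, the exchange lowers the total weight, and
shrinking cannot raise it. The descent ends at some S ⊆ T, and then S = T by minimality of T. The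
algorithm knows neither T nor the ranks; it tries all v and K.

The sets found wait in a queue, and a trie detects repetitions in time linear in n however many sets
are stored. Each pass of the main loop outputs one set and then explores its arcs, so the delay is
polynomial although the queue may become exponentially long (`mainLoop_spec`).

For the machine model, everything except the main loop is written with loops bounded by register 0,
which holds n. Such a program has a functional semantics and a polynomial time bound read off from
its syntax (`Cmd.exec`), and is verified with the invariant rule `Cmd.for_rule`. -/

/-- The part of a configuration that influences the computation. -/
structure Core where
  /-- contents of the registers -/
  reg : ℕ → ℕ
  /-- contents of the memory banks -/
  mem : ℕ → ℕ → ℕ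
  /-- the symbols written since the last completed output -/
  buf : List ℕ

/-- Forget the completed outputs and the time. -/
def State.core (s : State) : Core := ⟨s.reg, s.mem, s.buf⟩

/-- Assign the value `v` to register `r`. -/
def Core.setReg (c : Core) (r v : ℕ) : Core := { c with reg := Function.update c.reg r v }

/-- Write the value `v` to the cell with address `a` in memory bank `b`. -/
def Core.setMem (c : Core) (b a v : ℕ) : Core :=
  { c with mem := Function.update c.mem b (Function.update (c.mem b) a v) }

@[simp] theorem State.core_reg (s : State) : s.core.reg = s.reg := rfl
@[simp] theorem State.core_mem (s : State) : s.core.mem = s.mem := rfl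
@[simp] theorem State.core_buf (s : State) : s.core.buf = s.buf := rfl
@[simp] theorem State.core_tick (s : State) : s.tick.core = s.core := rfl
@[simp] theorem Core.setReg_reg (c : Core) (r v x : ℕ) :
    (c.setReg r v).reg x = if x = r then v else c.reg x := by
  simp [Core.setReg, Function.update_apply]
@[simp] theorem Core.setReg_mem (c : Core) (r v : ℕ) : (c.setReg r v).mem = c.mem := rfl
@[simp] theorem Core.setReg_buf (c : Core) (r v : ℕ) : (c.setReg r v).buf = c.buf := rfl
@[simp] theorem Core.setMem_reg (c : Core) (b a v : ℕ) : (c.setMem b a v).reg = c.reg := rfl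
@[simp] theorem Core.setMem_mem (c : Core) (b a v x : ℕ) :
    (c.setMem b a v).mem x = if x = b then Function.update (c.mem b) a v else c.mem x := by
  by_cases h : x = b
  · subst h; simp [Core.setMem]
  · simp [Core.setMem, h]
@[simp] theorem Core.setMem_buf (c : Core) (b a v : ℕ) : (c.setMem b a v).buf = c.buf := rfl

/-- The effect of an elementary instruction on the core. -/
def Instr.apply : Instr → Core → Core
  | const r k, c => c.setReg r k
  | copy r r', c => c.setReg r (c.reg r')
  | incr r, c => c.setReg r (c.reg r + 1)
  | decr r, c => c.setReg r (c.reg r - 1)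
  | load r b r', c => c.setReg r (c.mem b (c.reg r'))
  | store b r r', c => c.setMem b (c.reg r) (c.reg r')
  | write r, c => { c with buf := c.buf ++ [c.reg r] }
  | emit, c => { c with buf := [] }

/-- Whether an instruction may change register `x`. -/
def Instr.writes : Instr → ℕ → Bool
  | const r _, x => x == r
  | copy r _, x => x == r
  | incr r, x => x == r
  | decr r, x => x == r
  | load r _ _, x => x == r
  | _, _ => false

/-- Whether an instruction may change memory bank `x`. -/
def Instr.stores : Instr → ℕ → Bool
  | store b _ _, x => x == b
  | _, _ => false

/-- Whether an instruction leaves the output device alone. -/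
def Instr.silent : Instr → Bool
  | write _ => false
  | emit => false
  | _ => true

/-- Whether an instruction is not the completion of an output. -/
def Instr.noEmit : Instr → Bool
  | emit => false
  | _ => true

/-- The outcome of a test in terms of the register contents. -/
def Test.On : Test → (ℕ → ℕ) → Prop
  | eq r r', f => f r = f r'
  | lt r r', f => f r < f r'

instance (b : Test) (f : ℕ → ℕ) : Decidable (b.On f) := by
  cases b <;> simp only [Test.On] <;> infer_instance

@[simp] theorem Test.on_eq (r r' : ℕ) (f : ℕ → ℕ) : (Test.eq r r').On f ↔ f r = f r' := Iff.rfl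
@[simp] theorem Test.on_lt (r r' : ℕ) (f : ℕ → ℕ) : (Test.lt r r').On f ↔ f r < f r' := Iff.rfl

theorem Test.holds_iff (b : Test) (s : State) : b.Holds s ↔ b.On s.reg := by
  cases b <;> rfl

theorem Instr.core_run (i : Instr) (s : State) : (i.run s).core = i.apply s.core := by
  cases i <;> rfl

theorem Instr.time_run (i : Instr) (s : State) : (i.run s).time = s.time + 1 := by
  cases i <;> rfl

theorem Instr.out_run {i : Instr} (hi : i.noEmit = true) (s : State) : (i.run s).out = s.out := by
  cases i <;> first | rfl | simp [noEmit] at hi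

/-- Programs all of whose loops are of the form: for `r` from `0` to the content of register `0`
(exclusive). -/
inductive Cmd where
  | skip
  | basic (i : Instr)
  | seq (P Q : Cmd)
  | ite (b : Test) (P Q : Cmd)
  | for_ (r : ℕ) (P : Cmd)

namespace Cmd

/-- Translation into machine programs. -/
def toProg : Cmd → Prog
  | skip => .skip
  | basic i => .basic i
  | seq P Q => .seq P.toProg Q.toProg
  | ite b P Q => .ite b P.toProg Q.toProg
  | for_ r P => .seq (.basic (.const r 0)) (.loop (.lt r 0) (.seq P.toProg (.basic (.incr r))))

/-- The effect of a program on the core. -/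
def eval : Cmd → Core → Core
  | skip, c => c
  | basic i, c => i.apply c
  | seq P Q, c => Q.eval (P.eval c)
  | ite b P Q, c => if b.On c.reg then P.eval c else Q.eval c
  | for_ r P, c => (fun c => (Instr.incr r).apply (P.eval c))^[c.reg 0] (c.setReg r 0)

/-- Whether a program may change register `x`. -/
def writes : Cmd → ℕ → Bool
  | skip, _ => false
  | basic i, x => i.writes x
  | seq P Q, x => P.writes x || Q.writes x
  | ite _ P Q, x => P.writes x || Q.writes x
  | for_ r P, x => x == r || P.writes x

/-- Whether a program may change memory bank `x`. -/
def stores : Cmd → ℕ → Bool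
  | skip, _ => false
  | basic i, x => i.stores x
  | seq P Q, x => P.stores x || Q.stores x
  | ite _ P Q, x => P.stores x || Q.stores x
  | for_ _ P, x => P.stores x

/-- Whether a program leaves the output device alone. -/
def silent : Cmd → Bool
  | skip => true
  | basic i => i.silent
  | seq P Q => P.silent && Q.silent
  | ite _ P Q => P.silent && Q.silent
  | for_ _ P => P.silent

/-- Whether a program completes no output, and changes neither register `0` nor, in the body of a
loop, the loop variable. -/
def safe : Cmd → Bool
  | skip => true
  | basic i => i.noEmit && !i.writes 0
  | seq P Q => P.safe && Q.safe
  | ite _ P Q => P.safe && Q.safe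
  | for_ r P => r != 0 && P.safe && !P.writes r

/-- A bound on the running time, in terms of the content of register `0`. -/
noncomputable def cost : Cmd → Polynomial ℕ
  | skip => 0
  | basic _ => 1
  | seq P Q => P.cost + Q.cost
  | ite _ P Q => 1 + P.cost + Q.cost
  -- Outside the iterations: the initialisation and the final failing test. Per iteration: one test
  -- and one increment besides the body.
  | for_ _ P => 2 + Polynomial.X * (P.cost + 2)

/-! ### Frame rules, the loop rule and the running time of structured programs. -/

theorem eval_basic (i : Instr) (c : Core) : (basic i).eval c = i.apply c := rfl

theorem eval_seq (P Q : Cmd) (c : Core) : (seq P Q).eval c = Q.eval (P.eval c) := rfl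

/-- A frame rule: `writes` is computable, so for concrete programs the hypothesis holds by `rfl` and
specifications need not list what stays unchanged. -/
theorem eval_reg {P : Cmd} {x : ℕ} (h : P.writes x = false) (c : Core) :
    (P.eval c).reg x = c.reg x := by
  induction P generalizing c with
  | skip => rfl
  | basic i => cases i <;> simp_all [writes, Instr.writes, eval, Instr.apply]
  | seq P Q ihP ihQ =>
    simp only [writes, Bool.or_eq_false_iff] at h
    rw [eval, ihQ h.2, ihP h.1]
  | ite b P Q ihP ihQ =>
    simp only [writes, Bool.or_eq_false_iff] at h
    rw [eval]
    split_ifs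
    exacts [ihP h.1 c, ihQ h.2 c]
  | for_ r P ih =>
    simp only [writes, Bool.or_eq_false_iff, beq_eq_false_iff_ne] at h
    rw [eval]
    refine Function.Iterate.rec (fun d : Core => d.reg x = c.reg x) ?_ (fun d hd => ?_) _
    · simp [h.1]
    · simp [Instr.apply, h.1, ih h.2, hd]

theorem eval_mem {P : Cmd} {x : ℕ} (h : P.stores x = false) (c : Core) :
    (P.eval c).mem x = c.mem x := by
  induction P generalizing c with
  | skip => rfl
  | basic i => cases i <;> simp_all [stores, Instr.stores, eval, Instr.apply]
  | seq P Q ihP ihQ =>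
    simp only [stores, Bool.or_eq_false_iff] at h
    rw [eval, ihQ h.2, ihP h.1]
  | ite b P Q ihP ihQ =>
    simp only [stores, Bool.or_eq_false_iff] at h
    rw [eval]
    split_ifs
    exacts [ihP h.1 c, ihQ h.2 c]
  | for_ r P ih =>
    simp only [stores] at h
    rw [eval]
    refine Function.Iterate.rec (fun d : Core => d.mem x = c.mem x) ?_ (fun d hd => ?_) _
    · simp
    · simp [Instr.apply, ih h, hd]

theorem eval_buf {P : Cmd} (h : P.silent = true) (c : Core) : (P.eval c).buf = c.buf := by
  induction P generalizing c with
  | skip => rfl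
  | basic i => cases i <;> simp_all [silent, Instr.silent, eval, Instr.apply]
  | seq P Q ihP ihQ =>
    simp only [silent, Bool.and_eq_true] at h
    rw [eval, ihQ h.2, ihP h.1]
  | ite b P Q ihP ihQ =>
    simp only [silent, Bool.and_eq_true] at h
    rw [eval]
    split_ifs
    exacts [ihP h.1 c, ihQ h.2 c]
  | for_ r P ih =>
    simp only [silent] at h
    rw [eval]
    refine Function.Iterate.rec (fun d : Core => d.buf = c.buf) ?_ (fun d hd => ?_) _
    · simp
    · simp [Instr.apply, ih h, hd]

/-- Register 0 bounds all loops and is the argument of `cost`, so costs of consecutive pieces can be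
added only because it is constant. -/
theorem writes_zero {P : Cmd} (h : P.safe = true) : P.writes 0 = false := by
  induction P with
  | skip => rfl
  | basic i => simp_all [safe, writes]
  | seq P Q ihP ihQ => simp_all [safe, writes]
  | ite b P Q ihP ihQ => simp_all [safe, writes]
  | for_ r P ih => simp_all [safe, writes, Ne.symm]

/-- The invariant rule for loops.  The invariant may be used together with the facts that the loop
variable has the expected value and that everything the loop does not write to is unchanged. -/
theorem for_rule {r : ℕ} {P : Cmd} {c : Core} (hs : (for_ r P).safe = true)
    (Inv : ℕ → Core → Prop) (h0 : Inv 0 (c.setReg r 0))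
    (hstep : ∀ k < c.reg 0, ∀ d : Core, d.reg r = k →
      (∀ x, (for_ r P).writes x = false → d.reg x = c.reg x) →
      (∀ x, (for_ r P).stores x = false → d.mem x = c.mem x) →
      Inv k d → Inv (k + 1) ((P.eval d).setReg r (k + 1))) :
    Inv (c.reg 0) ((for_ r P).eval c) := by
  have hs' := hs
  simp only [safe, Bool.and_eq_true, bne_iff_ne, ne_eq, Bool.not_eq_true'] at hs
  suffices h : ∀ k ≤ c.reg 0, ∀ d,
      d = (fun c => (Instr.incr r).apply (P.eval c))^[k] (c.setReg r 0) → d.reg r = k ∧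
      (∀ x, (for_ r P).writes x = false → d.reg x = c.reg x) ∧
      (∀ x, (for_ r P).stores x = false → d.mem x = c.mem x) ∧ Inv k d from
    (h _ le_rfl _ rfl).2.2.2
  intro k
  induction k with
  | zero =>
    rintro - d rfl
    refine ⟨by simp, fun x hx => ?_, fun x _ => rfl, h0⟩
    simp only [writes, Bool.or_eq_false_iff, beq_eq_false_iff_ne] at hx
    simp [hx.1]
  | succ k ih =>
    rintro hk d rfl
    obtain ⟨h1, h2, h3, h4⟩ := ih (by omega) _ rfl
    rw [Function.iterate_succ_apply']
    generalize (fun c => (Instr.incr r).apply (P.eval c))^[k] (c.setReg r 0) = d at *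
    have e : (Instr.incr r).apply (P.eval d) = (P.eval d).setReg r (k + 1) := by
      simp [Instr.apply, eval_reg hs.2, h1]
    rw [e]
    refine ⟨by simp, fun x hx => ?_, fun x hx => ?_, hstep k (by omega) d h1 h2 h3 h4⟩
    · have := h2 x hx
      simp only [writes, Bool.or_eq_false_iff, beq_eq_false_iff_ne] at hx
      simp [hx.1, eval_reg hx.2, this]
    · have := h3 x hx
      simp only [stores] at hx
      simp [eval_mem hx, this]

/-- A structured program halts, has the effect `eval`, and takes at most `cost` steps. -/
theorem exec {P : Cmd} (hs : P.safe = true) (s : State) :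
    ∃ s', Exec P.toProg s s' ∧ s'.core = P.eval s.core ∧ s'.out = s.out ∧
      s'.time ≤ s.time + P.cost.eval (s.reg 0) := by
  induction P generalizing s with
  | skip => exact ⟨s, .skip s, rfl, rfl, by simp⟩
  | basic i =>
    simp only [safe, Bool.and_eq_true] at hs
    exact ⟨i.run s, .basic i s, i.core_run s, Instr.out_run hs.1 s, by simp [cost, i.time_run s]⟩
  | seq P Q ihP ihQ =>
    simp only [safe, Bool.and_eq_true] at hs
    obtain ⟨s₁, e₁, c₁, o₁, t₁⟩ := ihP hs.1 s
    obtain ⟨s₂, e₂, c₂, o₂, t₂⟩ := ihQ hs.2 s₁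
    refine ⟨s₂, .seq e₁ e₂, by rw [c₂, c₁, eval], by rw [o₂, o₁], ?_⟩
    have : s₁.reg 0 = s.reg 0 := by
      rw [← s₁.core_reg, c₁, eval_reg (writes_zero hs.1), s.core_reg]
    simp only [cost, Polynomial.eval_add]
    rw [this] at t₂
    omega
  | ite b P Q ihP ihQ =>
    simp only [safe, Bool.and_eq_true] at hs
    simp only [cost, Polynomial.eval_add, Polynomial.eval_one]
    by_cases hb : b.Holds s
    · obtain ⟨s', e, hc, o, t⟩ := ihP hs.1 s.tick
      refine ⟨s', .iteTrue hb e, ?_, o, ?_⟩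
      · rw [hc, eval, State.core_reg, if_pos ((b.holds_iff s).1 hb), State.core_tick]
      · simp only [State.tick] at t
        omega
    · obtain ⟨s', e, hc, o, t⟩ := ihQ hs.2 s.tick
      refine ⟨s', .iteFalse hb e, ?_, o, ?_⟩
      · rw [hc, eval, State.core_reg, if_neg (fun h => hb ((b.holds_iff s).2 h)), State.core_tick]
      · simp only [State.tick] at t
        omega
  | for_ r P ih =>
    simp only [safe, Bool.and_eq_true, bne_iff_ne, ne_eq, Bool.not_eq_true'] at hs
    -- Induction on the number `m` of remaining iterations; the extra unit of time is the final
    -- failing test.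
    have key : ∀ m (s : State), s.reg r + m = s.reg 0 →
        ∃ s', Exec (.loop (.lt r 0) (.seq P.toProg (.basic (.incr r)))) s s' ∧
          s'.core = (fun c => (Instr.incr r).apply (P.eval c))^[m] s.core ∧ s'.out = s.out ∧
          s'.time ≤ s.time + 1 + m * (P.cost.eval (s.reg 0) + 2) := by
      intro m
      induction m with
      | zero =>
        intro s h
        exact ⟨s.tick, .loopFalse (by simp only [Test.Holds]; omega), rfl, rfl, by simp [State.tick]⟩
      | succ m ihm =>
        intro s h
        obtain ⟨s₁, e₁, c₁, o₁, t₁⟩ := ih hs.1.2 s.tick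
        have hr : s₁.reg r = s.reg r := by
          rw [← s₁.core_reg, c₁, eval_reg hs.2, State.core_tick, s.core_reg]
        have h0 : s₁.reg 0 = s.reg 0 := by
          rw [← s₁.core_reg, c₁, eval_reg (writes_zero hs.1.2), State.core_tick, s.core_reg]
        have q0 : ((Instr.incr r).run s₁).reg 0 = s.reg 0 := by
          simp [Instr.run, State.setReg, State.tick, Ne.symm hs.1.1, h0]
        obtain ⟨s₂, e₂, c₂, o₂, t₂⟩ := ihm ((Instr.incr r).run s₁) (by
          rw [q0, ← h]
          simp [Instr.run, State.setReg, State.tick, hr]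
          omega)
        refine ⟨s₂, .loopTrue (by simp only [Test.Holds]; omega) (.seq e₁ (.basic _ _)) e₂, ?_, ?_, ?_⟩
        · rw [c₂, Instr.core_run, c₁, Function.iterate_succ_apply, State.core_tick]
        · rw [o₂, Instr.out_run rfl, o₁]
          rfl
        · rw [q0, Instr.time_run] at t₂
          simp only [State.tick] at t₁
          rw [add_mul]
          omega
    obtain ⟨s', e, hc, o, t⟩ := key (s.reg 0) ((Instr.const r 0).run s) (by
      simp [Instr.run, State.setReg, State.tick, Ne.symm hs.1.1])
    refine ⟨s', .seq (.basic _ _) e, ?_, o, ?_⟩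
    · rw [hc, Instr.core_run]
      rfl
    · have q0 : ((Instr.const r 0).run s).reg 0 = s.reg 0 := by
        simp [Instr.run, State.setReg, State.tick, Ne.symm hs.1.1]
      rw [q0, Instr.time_run] at t
      simp only [cost, Polynomial.eval_add, Polynomial.eval_mul, Polynomial.eval_X,
        Polynomial.eval_ofNat]
      omega

end Cmd

end RAM

namespace TargetSet

/-! ### Target sets and closed sets -/

section Closed

variable {V : Type*} [Fintype V] {G : SimpleGraph V} {t : V → ℕ}

open Classical in
/-- `C` is closed if no further vertex becomes active when `C` is active. -/
def IsClosedSet (G : SimpleGraph V) (t : V → ℕ) (C : Finset V) : Prop :=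
  ∀ v, t v ≤ (C.filter fun u => G.Adj v u).card → v ∈ C

omit [Fintype V] in
open Classical in
theorem IsClosedSet.mem_of_subset {C A : Finset V} (hC : IsClosedSet G t C) (hA : A ⊆ C) {v : V}
    (hv : t v ≤ (A.filter fun u => G.Adj v u).card) : v ∈ C :=
  hC v (hv.trans (Finset.card_le_card (Finset.filter_subset_filter _ hA)))

open Classical in
theorem mem_active_succ {S : Finset V} {k : ℕ} {v : V} : v ∈ active G t S (k + 1) ↔
    v ∈ active G t S k ∨ t v ≤ ((active G t S k).filter fun u => G.Adj v u).card := by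
  simp [active]

theorem active_subset_succ (S : Finset V) (k : ℕ) : active G t S k ⊆ active G t S (k + 1) :=
  fun _ hv => mem_active_succ.2 (Or.inl hv)

theorem active_monotone (S : Finset V) : Monotone (active G t S) :=
  monotone_nat_of_le_succ (active_subset_succ S)

theorem active_subset_of_isClosedSet {S C : Finset V} (hC : IsClosedSet G t C) (h : S ⊆ C) (k : ℕ) :
    active G t S k ⊆ C := by
  induction k with
  | zero => exact h
  | succ k ih =>
    intro v hv
    exact (mem_active_succ.1 hv).elim (fun h => ih h) (fun h => hC.mem_of_subset ih h)

/-- As long as the active set is not closed, it gains a vertex in every round, which cannot happen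
more than |V| times. -/
theorem exists_isClosedSet_active (S : Finset V) :
    ∃ k ≤ Fintype.card V, IsClosedSet G t (active G t S k) := by
  by_contra! h
  have key : ∀ k ≤ Fintype.card V + 1, k ≤ (active G t S k).card := by
    intro k
    induction k with
    | zero => simp
    | succ k ih =>
      intro hk
      refine (ih (by omega)).trans_lt (Finset.card_lt_card ?_)
      refine ⟨active_subset_succ S k, fun hle => h k (by omega) fun v hv => ?_⟩
      exact hle (mem_active_succ.2 (Or.inr hv))
  have := (key _ le_rfl).trans (Finset.card_le_univ _)
  omega

/-- Activation stops at the least closed set containing `S`. This description is free of rounds, so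
it does not depend on the order in which vertices are activated. -/
theorem isTargetSet_iff_isClosedSet {S : Finset V} :
    IsTargetSet G t S ↔ ∀ C, IsClosedSet G t C → S ⊆ C → C = Finset.univ := by
  constructor
  · rintro ⟨k, hk⟩ C hC h
    exact Finset.univ_subset_iff.1 (hk ▸ active_subset_of_isClosedSet hC h k)
  · intro h
    obtain ⟨k, -, hk⟩ := exists_isClosedSet_active (G := G) (t := t) S
    exact ⟨k, h _ hk (active_monotone S (Nat.zero_le k))⟩

theorem isTargetSet_iff_active_card {S : Finset V} :
    IsTargetSet G t S ↔ active G t S (Fintype.card V) = Finset.univ := by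
  refine ⟨fun h => ?_, fun h => ⟨_, h⟩⟩
  obtain ⟨k, hk, hc⟩ := exists_isClosedSet_active (G := G) (t := t) S
  have := isTargetSet_iff_isClosedSet.1 h _ hc (active_monotone S (Nat.zero_le k))
  exact Finset.univ_subset_iff.1 (this ▸ active_monotone S hk)

theorem IsTargetSet.mono {S T : Finset V} (h : IsTargetSet G t S) (hST : S ⊆ T) :
    IsTargetSet G t T :=
  isTargetSet_iff_isClosedSet.2 fun C hC hT => isTargetSet_iff_isClosedSet.1 h C hC (hST.trans hT)

theorem isTargetSet_univ : IsTargetSet G t Finset.univ := ⟨0, rfl⟩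

/-- Target sets are closed under supersets, so a smaller target set would make some single deletion
a target set too. -/
theorem isMinimalTargetSet_of_erase [DecidableEq V] {S : Finset V} (h : IsTargetSet G t S)
    (he : ∀ v ∈ S, ¬ IsTargetSet G t (S.erase v)) : IsMinimalTargetSet G t S := by
  refine ⟨h, fun T hT hTS v hv => ?_⟩
  by_contra hvT
  exact he v hv (hT.mono (Finset.subset_erase.2 ⟨hTS, hvT⟩))

/-! ### Exchanges, and why they reach every minimal target set. -/

/-- In a target set, a vertex may be exchanged for sufficiently many of its neighbours. -/
theorem IsTargetSet.exchange [DecidableEq V] {S K : Finset V} {v : V} (h : IsTargetSet G t S)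
    (hK : ∀ u ∈ K, G.Adj v u) (hcard : t v ≤ K.card) : IsTargetSet G t ((S ∪ K).erase v) := by
  classical
  refine isTargetSet_iff_isClosedSet.2 fun C hC hsub => isTargetSet_iff_isClosedSet.1 h C hC ?_
  -- A closed set containing the exchanged set contains `K`, hence `v` by its threshold, hence all
  -- of `S`.
  have hKC : K ⊆ C := fun u hu => hsub (Finset.mem_erase.2
    ⟨fun e => G.loopless.irrefl v (e ▸ hK u hu), Finset.mem_union_right _ hu⟩)
  have hv : v ∈ C := hC.mem_of_subset hKC (by rwa [Finset.filter_true_of_mem hK])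
  intro u hu
  by_cases e : u = v
  · exact e ▸ hv
  · exact hsub (Finset.mem_erase.2 ⟨e, Finset.mem_union_left _ hu⟩)

open Classical in
/-- Every vertex outside `T` has enough neighbours that become active strictly before it. -/
theorem IsTargetSet.exists_rank {T : Finset V} (h : IsTargetSet G t T) : ∃ rank : V → ℕ,
    ∀ v ∉ T, ∃ K : Finset V, K.card = t v ∧ ∀ u ∈ K, G.Adj v u ∧ rank u < rank v := by
  obtain ⟨k, hk⟩ := h
  have hex : ∀ v, ∃ k, v ∈ active G t T k := fun v => ⟨k, hk ▸ Finset.mem_univ v⟩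
  -- The rank is the first round in which a vertex is active. It is positive outside `T`, and the
  -- neighbours active one round earlier have smaller rank.
  refine ⟨fun v => Nat.find (hex v), fun v hv => ?_⟩
  obtain ⟨m, hm⟩ : ∃ m, Nat.find (hex v) = m + 1 := Nat.exists_eq_succ_of_ne_zero fun h0 =>
    hv (by simpa [h0, active] using Nat.find_spec (hex v))
  have h1 : v ∈ active G t T (m + 1) := hm ▸ Nat.find_spec (hex v)
  have h2 : v ∉ active G t T m := Nat.find_min (hex v) (by omega)
  obtain ⟨K, hK, hc⟩ := Finset.exists_subset_card_eq ((mem_active_succ.1 h1).resolve_left h2)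
  refine ⟨K, hc, fun u hu => ?_⟩
  obtain ⟨hu1, hu2⟩ := Finset.mem_filter.1 (hK hu)
  exact ⟨hu2, (Nat.lt_succ_of_le (Nat.find_min' (hex u) hu1)).trans_eq hm.symm⟩

/-- A nonempty family of minimal target sets contains all of them if, whenever exchanging a vertex
of a member for at most `c` vertices gives a target set, a subset of the latter is a member. -/
theorem mem_of_exchange_closed [DecidableEq V] {c : ℕ} (ht : ∀ v, t v ≤ c) {F : Set (Finset V)} (hne : F.Nonempty)
    (hmin : ∀ S ∈ F, IsMinimalTargetSet G t S)
    (hF : ∀ S ∈ F, ∀ v, ∀ K : Finset V, K.card ≤ c → IsTargetSet G t ((S ∪ K).erase v) →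
      ∃ S' ∈ F, S' ⊆ (S ∪ K).erase v)
    {T : Finset V} (hT : IsMinimalTargetSet G t T) : T ∈ F := by
  obtain ⟨rank, hrank⟩ := hT.prop.exists_rank
  -- With base `c + 1`, a vertex outside `T` outweighs any `c` vertices of smaller rank together.
  set w : V → ℕ := fun v => if v ∈ T then 0 else (c + 1) ^ rank v with hw
  obtain ⟨S, hS⟩ := hne
  induction hm : ∑ v ∈ S, w v using Nat.strong_induction_on generalizing S with
  | _ m ih =>
    by_cases hsub : S ⊆ T
    · rwa [Minimal.eq_of_le hT (hmin S hS).prop hsub] at hS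
    obtain ⟨v, hvS, hvT⟩ := Finset.not_subset.1 hsub
    obtain ⟨K, hKc, hK⟩ := hrank v hvT
    obtain ⟨S', hS', hle⟩ := hF S hS v K (hKc ▸ ht v)
      ((hmin S hS).prop.exchange (fun u hu => (hK u hu).1) hKc.ge)
    refine ih _ ?_ S' hS' rfl
    have hKw : ∑ u ∈ K, w u < w v := by
      have hpow : ∀ u ∈ K, w u * (c + 1) ≤ w v := by
        intro u hu
        simp only [hw, if_neg hvT]
        split_ifs
        · simp
        · rw [← pow_succ]
          exact Nat.pow_le_pow_right (by omega) (hK u hu).2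
      -- Sum `hpow` over the at most `c` vertices of `K`; as `w v > 0`, this forces the weight of
      -- `K` below `w v`.
      have h1 : (∑ u ∈ K, w u) * (c + 1) ≤ c * w v := by
        rw [Finset.sum_mul]
        refine (Finset.sum_le_card_nsmul _ _ _ hpow).trans ?_
        rw [smul_eq_mul]
        exact Nat.mul_le_mul_right _ (hKc ▸ ht v)
      have h2 : 0 < w v := by
        simp only [hw, if_neg hvT]
        positivity
      by_contra! h3
      nlinarith
    calc ∑ u ∈ S', w u ≤ ∑ u ∈ S.erase v ∪ K, w u := by
          refine Finset.sum_le_sum_of_subset (hle.trans fun u hu => ?_)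
          simp only [Finset.mem_erase, Finset.mem_union] at hu ⊢
          tauto
      _ ≤ ∑ u ∈ S.erase v, w u + ∑ u ∈ K, w u := by
          rw [← Finset.sum_union_inter]; omega
      _ < ∑ u ∈ S.erase v, w u + w v := by omega
      _ = m := by rw [Finset.sum_erase_add _ _ hvS, hm]

end Closed

end TargetSet

open RAM

namespace TargetSet

/-! ### Testing whether a set is a target set -/

section Test

variable {n : ℕ} {G : SimpleGraph (Fin n)} {t : Fin n → ℕ}

/-- The first `n` cells of `f` hold the characteristic vector of `S`. -/
def Represents (f : ℕ → ℕ) (S : Finset (Fin n)) : Prop :=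
  ∀ i : Fin n, f i = if i ∈ S then 1 else 0

open Classical in
/-- The cells of `f` hold the graph `G` and the thresholds `t`, as in `encodeInstance`. -/
def IsInput (G : SimpleGraph (Fin n)) (t : Fin n → ℕ) (f : ℕ → ℕ) : Prop :=
  (∀ i j : Fin n, f (1 + i * n + j) = if G.Adj i j then 1 else 0) ∧
    ∀ v : Fin n, f (1 + n * n + v) = t v

theorem isInput_encodeInstance (G : SimpleGraph (Fin n)) (t : Fin n → ℕ) :
    IsInput G t fun a => (encodeInstance G t).getD a 0 := by
  classical
  constructor
  · intro i j
    have hlt : (i : ℕ) * n + j < n * n := by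
      have := i.2
      have := j.2
      nlinarith
    have e1 : (⟨i * n + j, hlt⟩ : Fin (n * n)).divNat = i := Fin.ext (by
      simp [Fin.divNat, Nat.mul_comm (i : ℕ) n,
        Nat.mul_add_div (Nat.pos_of_lt_mul_left hlt)])
    have e2 : (⟨i * n + j, hlt⟩ : Fin (n * n)).modNat = j := Fin.ext (by
      simp [Fin.modNat, Nat.mod_eq_of_lt j.2])
    simp only [encodeInstance]
    rw [Nat.add_assoc, Nat.add_comm 1, List.getD_cons_succ,
      List.getD_append _ _ _ _ (by simpa using hlt), List.getD_eq_getElem _ _ (by simpa using hlt),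
      List.getElem_ofFn, e1, e2]
  · intro v
    simp only [encodeInstance]
    rw [Nat.add_assoc, Nat.add_comm 1, List.getD_cons_succ,
      List.getD_append_right _ _ _ _ (by simp), List.getD_eq_getElem _ _ (by simp)]
    simp

/-- Copy the first cells of bank `a` to bank `b`. -/
def copyBank (a b : ℕ) : Cmd :=
  .for_ 10 (.seq (.basic (.load 11 a 10)) (.basic (.store b 10 11)))

theorem copyBank_spec {a b : ℕ} (hab : a ≠ b) (c : Core) :
    ∀ i < c.reg 0, ((copyBank a b).eval c).mem b i = c.mem a i := by
  refine Cmd.for_rule (r := 10) rfl (fun k d => ∀ i < k, d.mem b i = c.mem a i) (by simp) ?_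
  intro k hk d hr _ hm ih i hi
  have := hm a (by simp [Cmd.stores, Instr.stores, hab])
  simp only [Cmd.eval, Instr.apply, Core.setReg_reg, Core.setReg_mem, Core.setMem_mem, if_true, hr,
    this, Function.update_apply, Nat.reduceEqDiff, if_false]
  split_ifs with h
  · rw [h]
  · exact ih i (by omega)

/-- Count in register `17` the active neighbours of the vertex in register `15`. -/
def countNeighbours : Cmd :=
  .for_ 16 (.seq (.basic (.load 18 0 13)) (.seq (.basic (.incr 13)) (.seq (.basic (.load 19 1 16))
    (.seq (.basic (.const 20 0)) (.ite (.lt 20 18) (.ite (.lt 20 19) (.basic (.incr 17)) .skip)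
      .skip)))))

-- Register 13 is a pointer into the adjacency matrix. It ends at the start of the next row, so
-- consecutive visits need no multiplication to locate their rows.
open Classical in
theorem countNeighbours_spec {c : Core} (hn : c.reg 0 = n) (hin : IsInput G t (c.mem 0))
    {A : Finset (Fin n)} (hA : Represents (c.mem 1) A) {v : Fin n}
    (hp : c.reg 13 = 1 + v * n) (h0 : c.reg 17 = 0) :
    (countNeighbours.eval c).reg 17 = (A.filter fun u => G.Adj v u).card ∧
      (countNeighbours.eval c).reg 13 = 1 + (v + 1) * n := by
  have key := Cmd.for_rule (c := c) (r := 16) rfl (fun k d =>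
    d.reg 17 = ((A.filter fun u => G.Adj v u).filter fun u : Fin n => (u : ℕ) < k).card ∧
      d.reg 13 = 1 + v * n + k) (by simp [h0, hp]) ?_ (P :=
    (.seq (.basic (.load 18 0 13)) (.seq (.basic (.incr 13)) (.seq (.basic (.load 19 1 16))
    (.seq (.basic (.const 20 0)) (.ite (.lt 20 18) (.ite (.lt 20 19) (.basic (.incr 17)) .skip)
      .skip))))))
  · rw [hn] at key
    refine ⟨key.1.trans ?_, key.2.trans (by ring)⟩
    rw [Finset.filter_true_of_mem fun u _ => u.2]
  · rintro k hk d hr - hm ⟨h17, h13⟩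
    rw [hn] at hk
    have m0 := hm 0 rfl
    have m1 := hm 1 rfl
    have ha := hin.1 v ⟨k, hk⟩
    have hb := hA ⟨k, hk⟩
    simp only at ha hb
    have hset : ((A.filter fun u => G.Adj v u).filter fun u : Fin n => (u : ℕ) < k + 1) =
        if G.Adj v ⟨k, hk⟩ ∧ (⟨k, hk⟩ : Fin n) ∈ A then
          insert ⟨k, hk⟩ ((A.filter fun u => G.Adj v u).filter fun u : Fin n => (u : ℕ) < k)
        else ((A.filter fun u => G.Adj v u).filter fun u : Fin n => (u : ℕ) < k) := by
      ext u
      split_ifs with h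
      · simp only [Finset.mem_filter, Finset.mem_insert, Fin.ext_iff]
        constructor
        · rintro ⟨h1, h2⟩
          by_cases e : (u : ℕ) = k
          · exact Or.inl e
          · exact Or.inr ⟨h1, by omega⟩
        · rintro (e | ⟨h1, h2⟩)
          · obtain rfl : u = ⟨k, hk⟩ := Fin.ext e
            exact ⟨h.symm, by simp⟩
          · exact ⟨h1, by omega⟩
      · simp only [Finset.mem_filter]
        refine and_congr_right fun h1 => ⟨fun h2 => ?_, fun h2 => by omega⟩
        by_contra h3
        obtain rfl : u = ⟨k, hk⟩ := Fin.ext (by simp only; omega)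
        exact h h1.symm
    rw [hset]
    by_cases h1 : G.Adj v ⟨k, hk⟩ <;> by_cases h2 : (⟨k, hk⟩ : Fin n) ∈ A <;>
      constructor <;> simp [Cmd.eval, Instr.apply, m0, m1, h13, hr, ha, hb, h1, h2, h17] <;> omega

/-- Make the vertex in register `15` active if it has sufficiently many active neighbours. -/
def visit : Cmd :=
  .seq (.basic (.const 17 0)) (.seq countNeighbours (.seq (.basic (.load 18 0 14))
    (.seq (.basic (.incr 14)) (.ite (.lt 17 18) .skip
      (.seq (.basic (.const 19 1)) (.basic (.store 1 15 19)))))))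

open Classical in
theorem visit_spec {c : Core} (hn : c.reg 0 = n) (hin : IsInput G t (c.mem 0))
    {A : Finset (Fin n)} (hA : Represents (c.mem 1) A) {v : Fin n} (hv : c.reg 15 = v)
    (hp : c.reg 13 = 1 + v * n) (hq : c.reg 14 = 1 + n * n + v) :
    Represents ((visit.eval c).mem 1)
        (if t v ≤ (A.filter fun u => G.Adj v u).card then insert v A else A) ∧
      (visit.eval c).reg 13 = 1 + (v + 1) * n ∧ (visit.eval c).reg 14 = 1 + n * n + (v + 1) := by
  obtain ⟨h1, h2⟩ := countNeighbours_spec (c := c.setReg 17 0) (by simpa) hin hA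
    (v := v) (by simpa) (by simp)
  have h3 := Cmd.eval_reg (P := countNeighbours) (x := 14) rfl (c.setReg 17 0)
  have h4 := Cmd.eval_reg (P := countNeighbours) (x := 15) rfl (c.setReg 17 0)
  have h5 := Cmd.eval_mem (P := countNeighbours) (x := 0) rfl (c.setReg 17 0)
  have h6 := Cmd.eval_mem (P := countNeighbours) (x := 1) rfl (c.setReg 17 0)
  simp only [visit, Cmd.eval_seq, Cmd.eval_basic, Instr.apply]
  generalize countNeighbours.eval (c.setReg 17 0) = d at *
  simp only [Cmd.eval, Instr.apply]
  have hth := hin.2 v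
  simp only [Core.setReg_reg, Core.setReg_mem, Nat.reduceEqDiff, if_false] at h3 h4 h5 h6
  refine ⟨?_, ?_⟩
  on_goal 2 => split_ifs <;> simp [h2, h3, hq, Nat.add_assoc]
  by_cases h : t v ≤ (A.filter fun u => G.Adj v u).card
  · simp only [Test.on_lt, Core.setReg_reg, Core.setReg_mem, h1, h3, h4, h5, h6, hq, hv, hth,
      Nat.reduceEqDiff, if_false, if_true, if_pos h, if_neg (not_lt.2 h), Core.setMem_mem]
    intro i
    rw [Function.update_apply, hA i]
    by_cases e : i = v <;> simp [e, Fin.val_inj]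
  · simp only [Test.on_lt, Core.setReg_reg, Core.setReg_mem, h1, h3, h4, h5, h6, hq, hv, hth,
      Nat.reduceEqDiff, if_false, if_true, if_neg h, if_pos (not_le.1 h)]
    exact hA

/-- Visit all vertices. -/
def round : Cmd :=
  .seq (.basic (.const 13 1)) (.seq (.basic (.const 14 1))
    (.seq (.for_ 15 (.for_ 16 (.basic (.incr 14)))) (.for_ 15 visit)))

/-- The thresholds start at address 1 + n², and without a multiplication instruction n² is obtained
by counting. -/
theorem addSquare_spec (c : Core) : ((Cmd.for_ 15 (.for_ 16 (.basic (.incr 14)))).eval c).reg 14 =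
    c.reg 14 + c.reg 0 * c.reg 0 := by
  refine Cmd.for_rule (r := 15) rfl (fun k d => d.reg 14 = c.reg 14 + k * c.reg 0) (by simp) ?_
  intro k _ d _ hr _ ih
  have h0 := hr 0 rfl
  have := Cmd.for_rule (c := d) (r := 16) (P := .basic (.incr 14)) rfl
    (fun k e => e.reg 14 = d.reg 14 + k) (by simp) (fun k _ e _ _ _ ih => by
      simp [Cmd.eval, Instr.apply, ih, Nat.add_assoc])
  simp [this, ih, h0, Nat.add_assoc, Nat.add_mul]

-- Vertices are activated in place, so later visits see earlier activations and the result may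
-- exceed one synchronous round. It still contains that round and lies in every closed set
-- containing `A`, and these two bounds are all that the test needs.
open Classical in
theorem round_spec {c : Core} (hn : c.reg 0 = n) (hin : IsInput G t (c.mem 0))
    {A : Finset (Fin n)} (hA : Represents (c.mem 1) A) :
    ∃ B : Finset (Fin n), Represents ((round.eval c).mem 1) B ∧ A ⊆ B ∧
      (∀ v, t v ≤ (A.filter fun u => G.Adj v u).card → v ∈ B) ∧
      ∀ C, IsClosedSet G t C → A ⊆ C → B ⊆ C := by
  simp only [round, Cmd.eval_seq, Cmd.eval_basic, Instr.apply]
  have a0 := Cmd.eval_reg (P := .for_ 15 (.for_ 16 (.basic (.incr 14)))) (x := 0) rfl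
    ((c.setReg 13 1).setReg 14 1)
  have a13 := Cmd.eval_reg (P := .for_ 15 (.for_ 16 (.basic (.incr 14)))) (x := 13) rfl
    ((c.setReg 13 1).setReg 14 1)
  have a14 := addSquare_spec ((c.setReg 13 1).setReg 14 1)
  have am0 := Cmd.eval_mem (P := .for_ 15 (.for_ 16 (.basic (.incr 14)))) (x := 0) rfl
    ((c.setReg 13 1).setReg 14 1)
  have am1 := Cmd.eval_mem (P := .for_ 15 (.for_ 16 (.basic (.incr 14)))) (x := 1) rfl
    ((c.setReg 13 1).setReg 14 1)
  generalize (Cmd.for_ 15 (.for_ 16 (.basic (.incr 14)))).eval ((c.setReg 13 1).setReg 14 1) = d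
    at *
  simp only [Core.setReg_reg, Core.setReg_mem, Nat.reduceEqDiff, OfNat.zero_ne_ofNat, if_false,
    if_true, hn] at a0 a13 a14 am0 am1
  have key := Cmd.for_rule (c := d) (r := 15) (P := visit) rfl (fun k e =>
    e.reg 13 = 1 + k * n ∧ e.reg 14 = 1 + n * n + k ∧
    ∃ B : Finset (Fin n), Represents (e.mem 1) B ∧ A ⊆ B ∧
      (∀ v : Fin n, (v : ℕ) < k → t v ≤ (A.filter fun u => G.Adj v u).card → v ∈ B) ∧
      ∀ C, IsClosedSet G t C → A ⊆ C → B ⊆ C)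
    (by
      simp only [Core.setReg_reg, Core.setReg_mem, Nat.reduceEqDiff, if_false, a13, a14, am1]
      exact ⟨by simp, by simp, A, hA, subset_rfl, by simp, fun C _ h => h⟩) ?_
  · rw [a0] at key
    obtain ⟨-, -, B, hB, h1, h2, h3⟩ := key
    exact ⟨B, hB, h1, fun v => h2 v v.2, h3⟩
  · rintro k hk e hr hreg hmem ⟨h13, h14, B, hB, h1, h2, h3⟩
    rw [a0] at hk
    obtain ⟨g1, g2, g3⟩ := visit_spec (c := e) (v := ⟨k, hk⟩) (t := t) (G := G)
      ((hreg 0 rfl).trans a0) (by rw [hmem 0 rfl, am0]; exact hin) hB hr h13 h14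
    refine ⟨by simpa using g2, by simpa using g3, _, g1, ?_, ?_, ?_⟩
    · split_ifs
      · exact h1.trans (Finset.subset_insert _ _)
      · exact h1
    · intro v hv hle
      by_cases e : (v : ℕ) = k
      · obtain rfl : v = ⟨k, hk⟩ := Fin.ext e
        rw [if_pos (hle.trans (Finset.card_le_card (Finset.filter_subset_filter _ h1)))]
        exact Finset.mem_insert_self _ _
      · have := h2 v (by omega) hle
        split_ifs
        · exact Finset.mem_insert_of_mem this
        · exact this
    · intro C hC hAC
      split_ifs with hle
      · exact Finset.insert_subset (hC.mem_of_subset (h3 C hC hAC) hle) (h3 C hC hAC)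
      · exact h3 C hC hAC

/-- Set register `21` to one if the first cells of bank `1` are all nonzero, else to zero. -/
def allActive : Cmd :=
  .seq (.basic (.const 21 1)) (.for_ 15 (.seq (.basic (.load 18 1 15)) (.seq (.basic (.const 20 0))
    (.ite (.eq 18 20) (.basic (.const 21 0)) .skip))))

theorem allActive_spec {c : Core} (hn : c.reg 0 = n) {A : Finset (Fin n)}
    (hA : Represents (c.mem 1) A) :
    (allActive.eval c).reg 21 = if A = Finset.univ then 1 else 0 := by
  have key := Cmd.for_rule (c := c.setReg 21 1) (r := 15) (P := (.seq (.basic (.load 18 1 15))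
    (.seq (.basic (.const 20 0)) (.ite (.eq 18 20) (.basic (.const 21 0)) .skip)))) rfl
    (fun k d => (d.reg 21 = 1 ∧ ∀ v : Fin n, (v : ℕ) < k → v ∈ A) ∨
      (d.reg 21 = 0 ∧ A ≠ Finset.univ)) (by simp) ?_
  · simp only [Core.setReg_reg, OfNat.zero_ne_ofNat, if_false, hn] at key
    rcases key with ⟨h1, h2⟩ | ⟨h1, h2⟩
    · rw [if_pos (Finset.eq_univ_of_forall fun v => h2 v v.2)]
      exact h1
    · rw [if_neg h2]
      exact h1
  · intro k hk d hr _ hm ih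
    have hk' : k < n := by simpa [hn] using hk
    have h1 := hA ⟨k, hk'⟩
    have m1 := hm 1 rfl
    by_cases hmem : (⟨k, hk'⟩ : Fin n) ∈ A
    · rcases ih with ⟨i1, i2⟩ | ⟨i1, i2⟩
      · left
        refine ⟨by simp [Cmd.eval, Instr.apply, hr, m1, h1, hmem, i1], fun v hv => ?_⟩
        by_cases e : (v : ℕ) = k
        · exact (Fin.ext e : v = ⟨k, hk'⟩) ▸ hmem
        · exact i2 v (by omega)
      · right
        exact ⟨by simp [Cmd.eval, Instr.apply, hr, m1, h1, hmem, i1], i2⟩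
    · right
      exact ⟨by simp [Cmd.eval, Instr.apply, hr, m1, h1, hmem],
        fun h => hmem (h ▸ Finset.mem_univ _)⟩

/-- Set register `21` to one if bank `2` holds a target set, else to zero. -/
def check : Cmd := .seq (copyBank 2 1) (.seq (.for_ 12 round) allActive)

-- After `k` passes the array lies between the `k`-th synchronous active set and every closed set
-- containing `S`. After `n` passes both bounds decide whether it is everything.
open Classical in
theorem check_spec {c : Core} (hn : c.reg 0 = n) (hin : IsInput G t (c.mem 0))
    {S : Finset (Fin n)} (hS : Represents (c.mem 2) S) :
    (check.eval c).reg 21 = if IsTargetSet G t S then 1 else 0 := by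
  have hc := copyBank_spec (a := 2) (b := 1) (by simp) c
  have c0 := Cmd.eval_reg (P := copyBank 2 1) (x := 0) rfl c
  have cm0 := Cmd.eval_mem (P := copyBank 2 1) (x := 0) rfl c
  simp only [check, Cmd.eval_seq]
  generalize (copyBank 2 1).eval c = d at *
  have key := Cmd.for_rule (c := d) (r := 12) (P := round) rfl (fun k e =>
    ∃ A : Finset (Fin n), Represents (e.mem 1) A ∧ active G t S k ⊆ A ∧
      ∀ C, IsClosedSet G t C → S ⊆ C → A ⊆ C)
    ⟨S, fun i => by rw [Core.setReg_mem, hc i (hn ▸ i.2), hS i], subset_rfl, fun C _ h => h⟩ ?_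
  · rw [c0, hn] at key
    obtain ⟨A, hA, h1, h2⟩ := key
    rw [allActive_spec (by rw [Cmd.eval_reg rfl, c0, hn]) hA]
    refine if_congr ⟨fun h => ?_, fun h => ?_⟩ rfl rfl
    · exact isTargetSet_iff_isClosedSet.2 fun C hC hSC =>
        Finset.univ_subset_iff.1 (h ▸ h2 C hC hSC)
    · rw [isTargetSet_iff_active_card, Fintype.card_fin] at h
      exact Finset.univ_subset_iff.1 (h ▸ h1)
  · rintro k - e - hr hm ⟨A, hA, h1, h2⟩
    obtain ⟨B, hB, g1, g2, g3⟩ := round_spec (c := e) (G := G) (t := t)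
      (by rw [hr 0 rfl, c0, hn]) (by rw [hm 0 rfl, cm0]; exact hin) hA
    refine ⟨B, hB, fun v hv => ?_, fun C hC hSC => g3 C hC (h2 C hC hSC)⟩
    refine (mem_active_succ.1 hv).elim (fun h => g1 (h1 h)) fun h => g2 v (h.trans ?_)
    exact Finset.card_le_card (Finset.filter_subset_filter _ h1)

/-- Shrink the target set in bank `2` to a minimal target set. -/
def minimise : Cmd :=
  .for_ 22 (.seq (.basic (.const 23 0)) (.seq (.basic (.store 2 22 23)) (.seq check
    (.ite (.eq 21 23) (.seq (.basic (.const 24 1)) (.basic (.store 2 22 24))) .skip))))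

/-- One greedy pass suffices: a vertex that could not be deleted cannot be deleted later from a
smaller set, by monotonicity. -/
theorem minimise_spec {c : Core} (hn : c.reg 0 = n) (hin : IsInput G t (c.mem 0))
    {S : Finset (Fin n)} (hS : Represents (c.mem 2) S) (hT : IsTargetSet G t S) :
    ∃ S' ⊆ S, IsMinimalTargetSet G t S' ∧ Represents ((minimise.eval c).mem 2) S' := by
  classical
  have key := Cmd.for_rule (c := c) (r := 22) (P := (.seq (.basic (.const 23 0))
    (.seq (.basic (.store 2 22 23)) (.seq check
    (.ite (.eq 21 23) (.seq (.basic (.const 24 1)) (.basic (.store 2 22 24))) .skip))))) rfl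
    (fun k d => ∃ S' ⊆ S, IsTargetSet G t S' ∧ Represents (d.mem 2) S' ∧
      ∀ v ∈ S', (v : ℕ) < k → ¬ IsTargetSet G t (S'.erase v))
    ⟨S, subset_rfl, hT, hS, by simp⟩ ?_
  · rw [hn] at key
    obtain ⟨S', h1, h2, h3, h4⟩ := key
    exact ⟨S', h1, isMinimalTargetSet_of_erase h2 fun v hv => h4 v hv v.2, h3⟩
  · rintro k hk d hr hreg hmem ⟨S', h1, h2, h3, h4⟩
    rw [hn] at hk
    set v : Fin n := ⟨k, hk⟩
    have hv : (v : ℕ) = k := rfl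
    simp only [Cmd.eval, Instr.apply, Core.setReg_mem]
    have e3 : Represents ((((d.setReg 23 0).setMem 2 k 0)).mem 2) (S'.erase v) := by
      intro i
      by_cases e : i = v
      · simp [e, hv]
      · have : (i : ℕ) ≠ k := fun h => e (Fin.ext h)
        simp [this, e, h3 i]
    have ch := check_spec (c := (d.setReg 23 0).setMem 2 k 0) (G := G) (t := t)
      (by simp [hreg 0 rfl, hn]) (by simpa [hmem 0 rfl] using hin) e3
    have b22 := Cmd.eval_reg (P := check) (x := 22) rfl ((d.setReg 23 0).setMem 2 k 0)
    have b23 := Cmd.eval_reg (P := check) (x := 23) rfl ((d.setReg 23 0).setMem 2 k 0)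
    have bm := Cmd.eval_mem (P := check) (x := 2) rfl ((d.setReg 23 0).setMem 2 k 0)
    simp only [Core.setReg_reg, Nat.reduceEqDiff, if_true, if_false, hr]
    generalize check.eval ((d.setReg 23 0).setMem 2 k 0) = e at *
    simp only [Core.setReg_reg, Core.setMem_reg, Nat.reduceEqDiff, if_true, if_false, hr]
      at b22 b23
    simp only [Test.on_eq, ch, b22, b23]
    by_cases hE : IsTargetSet G t (S'.erase v)
    · refine ⟨S'.erase v, (Finset.erase_subset _ _).trans h1, hE, by simpa [hE, bm] using e3, ?_⟩
      intro u hu huk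
      have hu' := Finset.mem_erase.1 hu
      have : (u : ℕ) ≠ k := fun h => hu'.1 (Fin.ext h)
      exact fun h => h4 u hu'.2 (by omega)
        (h.mono (Finset.erase_subset_erase _ (Finset.erase_subset _ _)))
    -- Restoring the cell to one is correct: were `v` absent, erasing it would change nothing and
    -- the test would have succeeded.
    · have hvS : v ∈ S' := by
        by_contra h
        exact hE (by rwa [Finset.erase_eq_of_notMem h])
      refine ⟨S', h1, h2, ?_, ?_⟩
      · intro i
        by_cases e : i = v
        · simp [e, hv, hE, bm, hvS]
        · have : (i : ℕ) ≠ k := fun h => e (Fin.ext h)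
          simp [this, h3 i, hE, bm]
      · intro u hu huk
        by_cases e : u = v
        · exact e ▸ hE
        · have : (u : ℕ) ≠ k := fun h => e (Fin.ext h)
          exact h4 u hu (by omega)

end Test

end TargetSet

namespace TargetSet

/-! ### A dictionary and a queue -/

theorem charVector_injective {n : ℕ} : Function.Injective (charVector (n := n)) := by
  intro S T h
  ext v
  have := congrFun (List.ofFn_injective h) v
  by_cases h1 : v ∈ S <;> by_cases h2 : v ∈ T <;> simp_all

/-- The nodes `0, …, F` form a trie: `pre x` is the word spelled by the path from the root `0` to
the node `x`, and the words satisfying `seen` are those at marked nodes. -/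
structure IsTrie (F : ℕ) (child : ℕ → ℕ → ℕ) (mark : ℕ → ℕ) (pre : ℕ → List ℕ)
    (seen : List ℕ → Prop) : Prop where
  pre_zero : pre 0 = []
  pre_inj : ∀ x ≤ F, ∀ y ≤ F, pre x = pre y → x = y
  child_le : ∀ b < 2, ∀ x ≤ F, child b x ≤ F
  pre_child : ∀ b < 2, ∀ x ≤ F, child b x ≠ 0 → pre (child b x) = pre x ++ [b]
  pre_closed : ∀ x ≤ F, ∀ w b, pre x = w ++ [b] → ∃ y ≤ F, pre y = w
  pre_ne : ∀ b < 2, ∀ x ≤ F, child b x = 0 → ∀ y ≤ F, pre y ≠ pre x ++ [b]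
  child_of_lt : ∀ b < 2, ∀ x, F < x → child b x = 0
  mark_of_lt : ∀ x, F < x → mark x = 0
  mark_iff : ∀ x ≤ F, mark x ≠ 0 ↔ seen (pre x)
  exists_pre : ∀ w, seen w → ∃ x ≤ F, pre x = w

/-- The function `fun b => c.mem (b + 5)` reads unrelated banks for `b ≥ 2` (the marks for `b = 2`),
so agreement can be demanded only for the letters 0 and 1. -/
theorem IsTrie.congr {F : ℕ} {child child' : ℕ → ℕ → ℕ} {mark : ℕ → ℕ} {pre : ℕ → List ℕ}
    {seen : List ℕ → Prop} (h : IsTrie F child mark pre seen)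
    (hc : ∀ b < 2, child' b = child b) : IsTrie F child' mark pre seen := by
  obtain ⟨p1, p2, p3, p4, p5, p6, p7, p8, p9, p10⟩ := h
  refine ⟨p1, p2, ?_, ?_, p5, ?_, ?_, p8, p9, p10⟩ <;> intro b hb <;> rw [hc b hb]
  exacts [p3 b hb, p4 b hb, p6 b hb, p7 b hb]

/-- Node `F + 1` is blank by `child_of_lt` and `mark_of_lt`, so it needs no initialisation. By
`pre_ne` its word is new, which keeps `pre` injective, and by `pre_closed` no extension of that word
is present yet. -/
theorem IsTrie.addChild {F : ℕ} {child : ℕ → ℕ → ℕ} {mark : ℕ → ℕ} {pre : ℕ → List ℕ}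
    {seen : List ℕ → Prop} (h : IsTrie F child mark pre seen) {b x : ℕ} (hb : b < 2) (hx : x ≤ F)
    (h0 : child b x = 0) :
    IsTrie (F + 1) (Function.update child b (Function.update (child b) x (F + 1))) mark
      (Function.update pre (F + 1) (pre x ++ [b])) seen := by
  have hpre : ∀ y ≤ F, Function.update pre (F + 1) (pre x ++ [b]) y = pre y := fun y hy =>
    Function.update_of_ne (by omega) _ _
  have hnew := h.pre_ne b hb x hx h0
  have hch : ∀ b' y, Function.update child b (Function.update (child b) x (F + 1)) b' y =
      if b' = b ∧ y = x then F + 1 else child b' y := by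
    intro b' y
    by_cases e : b' = b
    · subst e
      simp [Function.update_apply]
    · simp [e]
  have hlen : ∀ y ≤ F, ∀ b', pre x ++ [b] ≠ pre y ++ [b'] ∨ (y = x ∧ b' = b) := by
    intro y hy b'
    by_cases e : pre x ++ [b] = pre y ++ [b']
    · obtain ⟨e1, e2⟩ := List.append_inj' e rfl
      exact Or.inr ⟨(h.pre_inj x hx y hy e1).symm, by simpa using e2.symm⟩
    · exact Or.inl e
  constructor
  · rw [hpre 0 (Nat.zero_le _), h.pre_zero]
  · intro y hy z hz e
    rcases Nat.lt_or_eq_of_le hy with hy | rfl <;> rcases Nat.lt_or_eq_of_le hz with hz | rfl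
    · rw [hpre y (by omega), hpre z (by omega)] at e
      exact h.pre_inj y (by omega) z (by omega) e
    · rw [hpre y (by omega), Function.update_self] at e
      exact absurd e (hnew y (by omega))
    · rw [hpre z (by omega), Function.update_self] at e
      exact absurd e.symm (hnew z (by omega))
    · rfl
  · intro b' hb' y hy
    rw [hch]
    split_ifs with e
    · exact le_rfl
    · rcases Nat.lt_or_eq_of_le hy with hy | rfl
      · exact (h.child_le b' hb' y (by omega)).trans (by omega)
      · rw [h.child_of_lt b' hb' _ (by omega)]
        omega
  · intro b' hb' y hy hne
    rw [hch] at hne ⊢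
    split_ifs at hne ⊢ with e
    · rw [Function.update_self, e.1, e.2, hpre x hx]
    · rcases Nat.lt_or_eq_of_le hy with hy | rfl
      · rw [hpre _ (h.child_le b' hb' y (by omega)), hpre y (by omega)]
        exact h.pre_child b' hb' y (by omega) hne
      · exact absurd (h.child_of_lt b' hb' _ (by omega)) hne
  · intro y hy w b' e
    rcases Nat.lt_or_eq_of_le hy with hy | rfl
    · rw [hpre y (by omega)] at e
      obtain ⟨z, hz, hz'⟩ := h.pre_closed y (by omega) w b' e
      exact ⟨z, by omega, by rw [hpre z hz, hz']⟩
    · rw [Function.update_self] at e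
      exact ⟨x, by omega, by rw [hpre x hx, (List.append_inj' e rfl).1]⟩
  · intro b' hb' y hy he z hz
    rw [hch] at he
    split_ifs at he with e
    rcases Nat.lt_or_eq_of_le hy with hy | rfl <;> rcases Nat.lt_or_eq_of_le hz with hz | rfl
    · rw [hpre y (by omega), hpre z (by omega)]
      exact h.pre_ne b' hb' y (by omega) he z (by omega)
    · rw [hpre y (by omega), Function.update_self]
      exact (hlen y (by omega) b').resolve_right fun e' => e ⟨e'.2, e'.1⟩
    · rw [hpre z (by omega), Function.update_self]
      intro e1
      obtain ⟨w, hw, hw'⟩ := h.pre_closed z (by omega) _ _ e1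
      exact hnew w hw hw'
    · rw [Function.update_self]
      intro e1
      have := congrArg List.length e1
      simp at this
  · intro b' hb' y hy
    rw [hch, if_neg (by omega)]
    exact h.child_of_lt b' hb' y (by omega)
  · exact fun y hy => h.mark_of_lt y (by omega)
  · intro y hy
    rcases Nat.lt_or_eq_of_le hy with hy | rfl
    · rw [hpre y (by omega)]
      exact h.mark_iff y (by omega)
    · rw [Function.update_self, h.mark_of_lt _ (by omega)]
      refine iff_of_false (by simp) fun hs => ?_
      obtain ⟨z, hz, hz'⟩ := h.exists_pre _ hs
      exact hnew z hz hz'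
  · intro w hw
    obtain ⟨y, hy, e⟩ := h.exists_pre w hw
    exact ⟨y, by omega, by rw [hpre y hy, e]⟩

/-- Move from the node in register `25` to its child for the letter `b`, which is created if it
does not exist. -/
def descend (b : ℕ) : Cmd :=
  .seq (.basic (.load 29 (b + 5) 25)) (.seq (.basic (.const 28 0)) (.seq
    (.ite (.eq 29 28) (.seq (.basic (.incr 5)) (.seq (.basic (.copy 29 5))
      (.basic (.store (b + 5) 25 29)))) .skip)
    (.basic (.copy 25 29))))

/-- The banks `5`, `6`, `7` hold a trie for `seen`, and register `25` the node of the word `w`. -/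
def AtNode (c : Core) (seen : List ℕ → Prop) (w : List ℕ) : Prop :=
  ∃ pre, IsTrie (c.reg 5) (fun b => c.mem (b + 5)) (c.mem 7) pre seen ∧ c.reg 25 ≤ c.reg 5 ∧
    pre (c.reg 25) = w

theorem descend_spec {c : Core} {seen : List ℕ → Prop} {w : List ℕ} (h : AtNode c seen w) {b : ℕ}
    (hb : b < 2) : AtNode ((descend b).eval c) seen (w ++ [b]) := by
  obtain ⟨pre, ht, hle, rfl⟩ := h
  by_cases h0 : c.mem (b + 5) (c.reg 25) = 0
  · have key := ht.addChild hb hle h0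
    have e : (descend b).eval c = ((((((c.setReg 29 0).setReg 28 0).setReg 5 (c.reg 5 + 1)).setReg
        29 (c.reg 5 + 1)).setMem (b + 5) (c.reg 25) (c.reg 5 + 1)).setReg 25 (c.reg 5 + 1)) := by
      simp [descend, Cmd.eval, Instr.apply, h0]
    rw [e]
    refine ⟨Function.update pre (c.reg 5 + 1) (pre (c.reg 25) ++ [b]), ?_, by simp, by simp⟩
    convert key using 1
    · simp
    · funext b'
      by_cases hb' : b' = b <;> simp [hb']
    · have : 7 ≠ b + 5 := by omega
      simp [this]
  · have e : (descend b).eval c = (((c.setReg 29 (c.mem (b + 5) (c.reg 25))).setReg 28 0).setReg 25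
        (c.mem (b + 5) (c.reg 25))) := by
      simp [descend, Cmd.eval, Instr.apply, h0]
    rw [e]
    refine ⟨pre, by simpa using ht, ?_, ?_⟩
    · simpa using ht.child_le b hb _ hle
    · simpa using ht.pre_child b hb _ hle h0

/-- Find the node of the word in bank `2`. -/
def walk : Cmd :=
  .seq (.basic (.const 25 0)) (.for_ 26 (.seq (.basic (.load 27 2 26)) (.seq (.basic (.const 28 0))
    (.ite (.lt 28 27) (descend 1) (descend 0)))))

/-- Nodes created on the way carry no mark, so `seen` is unaffected even if the word was absent;
only the labelling `pre` may change. -/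
theorem walk_spec {n : ℕ} {c : Core} (hn : c.reg 0 = n) {S : Finset (Fin n)}
    (hS : Represents (c.mem 2) S) {seen : List ℕ → Prop} {pre : ℕ → List ℕ}
    (h : IsTrie (c.reg 5) (fun b => c.mem (b + 5)) (c.mem 7) pre seen) :
    AtNode (walk.eval c) seen (charVector S) := by
  have hlen : (charVector S).length = n := by simp [charVector]
  have key := Cmd.for_rule (c := c.setReg 25 0) (r := 26) (P := .seq (.basic (.load 27 2 26))
    (.seq (.basic (.const 28 0)) (.ite (.lt 28 27) (descend 1) (descend 0)))) rfl
    (fun k d => AtNode d seen ((charVector S).take k))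
    ⟨pre, by simpa using h, by simp, by simpa using h.pre_zero⟩ ?_
  · simp only [Core.setReg_reg, OfNat.zero_ne_ofNat, if_false, hn] at key
    rwa [List.take_of_length_le hlen.le] at key
  · intro k hk d hr _ hm ih
    have hk' : k < n := by simpa [hn] using hk
    have m2 : d.mem 2 k = _ := (congrFun (hm 2 rfl) k).trans (hS ⟨k, hk'⟩)
    have hat : AtNode ((d.setReg 27 (d.mem 2 k)).setReg 28 0) seen ((charVector S).take k) := by
      obtain ⟨pre, h1, h2, h3⟩ := ih
      exact ⟨pre, by simpa using h1, by simpa using h2, by simpa using h3⟩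
    have hset : ∀ e w, AtNode e seen w → AtNode (e.setReg 26 (k + 1)) seen w := by
      rintro e w ⟨pre, h1, h2, h3⟩
      exact ⟨pre, by simpa using h1, by simpa using h2, by simpa using h3⟩
    apply hset
    rw [List.take_succ_eq_append_getElem (hlen.symm ▸ hk')]
    simp only [Cmd.eval, Instr.apply, Test.on_lt, hr]
    by_cases hmem : (⟨k, hk'⟩ : Fin n) ∈ S
    · rw [if_pos (by simp [m2, hmem])]
      simpa [charVector, hmem] using descend_spec hat (b := 1) (by omega)
    · rw [if_neg (by simp [m2, hmem])]
      simpa [charVector, hmem] using descend_spec hat (b := 0) (by omega)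

/-! ### The queue and insertion without repetition. -/

/-- Append the first cells of bank `2` to the queue in bank `4`. -/
def enqueue : Cmd :=
  .for_ 26 (.seq (.basic (.load 27 2 26)) (.seq (.basic (.store 4 2 27)) (.basic (.incr 2))))

theorem enqueue_spec (c : Core) : (enqueue.eval c).reg 2 = c.reg 2 + c.reg 0 ∧
    (∀ i < c.reg 0, (enqueue.eval c).mem 4 (c.reg 2 + i) = c.mem 2 i) ∧
    ∀ a < c.reg 2, (enqueue.eval c).mem 4 a = c.mem 4 a := by
  refine Cmd.for_rule (r := 26) rfl (fun k d => d.reg 2 = c.reg 2 + k ∧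
    (∀ i < k, d.mem 4 (c.reg 2 + i) = c.mem 2 i) ∧ ∀ a < c.reg 2, d.mem 4 a = c.mem 4 a)
    (by simp) ?_
  rintro k - d hr - hm ⟨h1, h2, h3⟩
  have m2 := hm 2 rfl
  refine ⟨by simp [Cmd.eval, Instr.apply, h1, Nat.add_assoc], fun i hi => ?_, fun a ha => ?_⟩
  · by_cases e : i = k
    · simp [Cmd.eval, Instr.apply, h1, hr, m2, e]
    · simpa [Cmd.eval, Instr.apply, h1, e] using h2 i (by omega)
  · have : a ≠ c.reg 2 + k := by omega
    simpa [Cmd.eval, Instr.apply, h1, this] using h3 a ha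

/-- The queue in bank `4` consists of the sets in `Q`, and the trie contains precisely these. -/
structure Holds {n : ℕ} (c : Core) (Q : List (Finset (Fin n))) : Prop where
  trie : ∃ pre, IsTrie (c.reg 5) (fun b => c.mem (b + 5)) (c.mem 7) pre
    (fun w => ∃ S ∈ Q, charVector S = w)
  tail : c.reg 2 = Q.length * n
  count : c.reg 4 = Q.length
  queue : ∀ j (hj : j < Q.length), ∀ i : Fin n, c.mem 4 (j * n + i) = if i ∈ Q[j] then 1 else 0
  nodup : Q.Nodup

theorem Holds.congr {n : ℕ} {c d : Core} {Q : List (Finset (Fin n))} (h : Holds c Q)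
    (h2 : d.reg 2 = c.reg 2) (h4 : d.reg 4 = c.reg 4) (h5 : d.reg 5 = c.reg 5)
    (hm : ∀ b ∈ [4, 5, 6, 7], d.mem b = c.mem b) : Holds d Q := by
  obtain ⟨⟨pre, ht⟩, tail, count, queue, nodup⟩ := h
  refine ⟨⟨pre, ?_⟩, h2.trans tail, h4.trans count, ?_, nodup⟩
  · rw [h5, hm 7 (by simp)]
    refine ht.congr fun b hb => ?_
    interval_cases b
    exacts [hm 5 (by simp), hm 6 (by simp)]
  · rw [hm 4 (by simp)]
    exact queue

/-- Append the set in bank `2` to the queue unless it was appended before. -/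
def insert : Cmd :=
  .seq walk (.seq (.basic (.load 29 7 25)) (.seq (.basic (.const 28 0)) (.ite (.eq 29 28)
    (.seq (.basic (.const 29 1)) (.seq (.basic (.store 7 25 29)) (.seq (.basic (.incr 4)) enqueue)))
    .skip)))

theorem IsTrie.setMark {F : ℕ} {child : ℕ → ℕ → ℕ} {mark : ℕ → ℕ} {pre : ℕ → List ℕ}
    {seen seen' : List ℕ → Prop} (h : IsTrie F child mark pre seen) {x : ℕ} (hx : x ≤ F)
    (hs : ∀ w, seen' w ↔ seen w ∨ w = pre x) :
    IsTrie F child (Function.update mark x 1) pre seen' := by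
  obtain ⟨p1, p2, p3, p4, p5, p6, p7, p8, p9, p10⟩ := h
  refine ⟨p1, p2, p3, p4, p5, p6, p7, fun y hy => ?_, fun y hy => ?_, fun w hw => ?_⟩
  · rw [Function.update_of_ne (by omega), p8 y hy]
  · rw [hs, ← p9 y hy]
    by_cases e : y = x
    · simp [e]
    · rw [Function.update_of_ne e]
      exact ⟨Or.inl, fun h => h.resolve_right fun h => e (p2 y hy x hx h)⟩
  · rcases (hs w).1 hw with h | rfl
    · exact p10 w h
    · exact ⟨x, hx, rfl⟩

/-- By injectivity of `charVector`, the mark at the node of `S` tells whether `S` is in the queue.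
The prefix relation matters because the main loop addresses the queue by position. -/
theorem insert_spec {n : ℕ} {c : Core} (hn : c.reg 0 = n) {S : Finset (Fin n)}
    (hS : Represents (c.mem 2) S) {Q : List (Finset (Fin n))} (h : Holds c Q) :
    ∃ Q', Q <+: Q' ∧ S ∈ Q' ∧ (∀ T ∈ Q', T ∈ Q ∨ T = S) ∧ Holds (insert.eval c) Q' := by
  obtain ⟨⟨pre, ht⟩, tail, count, queue, nodup⟩ := h
  obtain ⟨pre, ht, hle, hpre⟩ := walk_spec hn hS ht
  have w0 := Cmd.eval_reg (P := walk) (x := 0) rfl c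
  have w2 := Cmd.eval_reg (P := walk) (x := 2) rfl c
  have w4 := Cmd.eval_reg (P := walk) (x := 4) rfl c
  have v2 := Cmd.eval_mem (P := walk) (x := 2) rfl c
  have v4 := Cmd.eval_mem (P := walk) (x := 4) rfl c
  simp only [insert, Cmd.eval_seq, Cmd.eval_basic, Instr.apply]
  generalize walk.eval c = d at *
  have hseen : d.mem 7 (d.reg 25) ≠ 0 ↔ S ∈ Q := by
    rw [ht.mark_iff _ hle, hpre]
    exact ⟨fun ⟨T, hT, e⟩ => charVector_injective e ▸ hT, fun hT => ⟨S, hT, rfl⟩⟩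
  by_cases hmem : S ∈ Q
  · refine ⟨Q, List.prefix_rfl, hmem, fun T hT => Or.inl hT, ?_⟩
    rw [Cmd.eval, if_neg (by simpa using hseen.2 hmem), Cmd.eval]
    exact ⟨⟨pre, by simpa using ht⟩, by simpa [w2] using tail, by simpa [w4] using count,
      by simpa [v4] using queue, nodup⟩
  · refine ⟨Q ++ [S], List.prefix_append _ _, by simp, by simp, ?_⟩
    have h0 : d.mem 7 (d.reg 25) = 0 := by
      by_contra h
      exact hmem (hseen.1 h)
    rw [Cmd.eval, if_pos (by simpa using h0)]
    simp only [Cmd.eval_seq, Cmd.eval_basic, Instr.apply]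
    set e : Core := ((((((d.setReg 29 (d.mem 7 (d.reg 25))).setReg 28 0).setReg 29 1).setMem 7 _
      _)).setReg 4 _) with he
    have hq := enqueue_spec e
    have q4 := Cmd.eval_reg (P := enqueue) (x := 4) rfl e
    have q5 := Cmd.eval_reg (P := enqueue) (x := 5) rfl e
    have r5 := Cmd.eval_mem (P := enqueue) (x := 5) rfl e
    have r6 := Cmd.eval_mem (P := enqueue) (x := 6) rfl e
    have r7 := Cmd.eval_mem (P := enqueue) (x := 7) rfl e
    have e0 : e.reg 0 = n := by simp [he, w0, hn]
    have e2 : e.reg 2 = Q.length * n := by simp [he, w2, tail]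
    have e4 : e.reg 4 = Q.length + 1 := by simp [he, w4, count]
    have e5 : e.reg 5 = d.reg 5 := by simp [he]
    have f2 : e.mem 2 = c.mem 2 := by simp [he, v2]
    have f4 : e.mem 4 = c.mem 4 := by simp [he, v4]
    have f5 : e.mem 5 = d.mem 5 := by simp [he]
    have f6 : e.mem 6 = d.mem 6 := by simp [he]
    have f7 : e.mem 7 = Function.update (d.mem 7) (d.reg 25) 1 := by simp [he]
    clear_value e
    rw [e0, e2, f2, f4] at hq
    obtain ⟨q1, q2, q3⟩ := hq
    refine ⟨⟨pre, ?_⟩, ?_, ?_, ?_, ?_⟩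
    · rw [q5, e5, r7, f7]
      refine (ht.congr fun b hb => ?_).setMark hle fun w => ?_
      · interval_cases b
        exacts [r5.trans f5, r6.trans f6]
      · simp [or_and_right, exists_or, hpre, eq_comm]
    · rw [q1, List.length_append, Nat.add_mul]
      simp
    · rw [q4, e4]
      simp
    · intro j hj i
      rcases Nat.lt_or_ge j Q.length with hlt | hge
      · rw [q3 _ (by have := i.2; nlinarith), List.getElem_append_left hlt]
        exact queue j hlt i
      · have hj' : j = Q.length := by
          simp only [List.length_append, List.length_singleton] at hj
          omega
        subst hj'
        rw [q2 _ i.2, hS i]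
        simp
    · exact List.nodup_append.2 ⟨nodup, by simp, by
        rintro a ha b hb rfl
        exact hmem ((List.mem_singleton.1 hb) ▸ ha)⟩

end TargetSet

namespace TargetSet

/-! ### Exchanging a vertex -/

/-- Run a program for all values of the registers `100, …, 99 + j` below the content of register
`0`. -/
def nest : ℕ → Cmd → Cmd
  | 0, P => P
  | j + 1, P => .for_ (100 + j) (nest j P)

theorem nest_writes (j : ℕ) (P : Cmd) (x : ℕ) :
    (nest j P).writes x = (P.writes x || decide (100 ≤ x ∧ x < 100 + j)) := by
  induction j with
  | zero => simp [nest]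
  | succ j ih =>
    rw [nest, Cmd.writes, ih, Bool.eq_iff_iff]
    simp only [Bool.or_eq_true, beq_iff_eq, decide_eq_true_eq]
    have : (x = 100 + j ∨ 100 ≤ x ∧ x < 100 + j) ↔ 100 ≤ x ∧ x < 100 + (j + 1) := by omega
    rw [← this]
    tauto

theorem nest_silent (j : ℕ) (P : Cmd) : (nest j P).silent = P.silent := by
  induction j with
  | zero => rfl
  | succ j ih => rw [nest, Cmd.silent, ih]

theorem nest_safe {P : Cmd} (hP : P.safe = true) (hw : ∀ x, 100 ≤ x → P.writes x = false) (j : ℕ) :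
    (nest j P).safe = true := by
  induction j with
  | zero => exact hP
  | succ j ih =>
    simp [nest, Cmd.safe, ih, nest_writes, hw]

/-- An invariant rule for nested loops: `Goal f` records that the tuple `f` has been treated and
survives growth of the list, so each loop accumulates the goals of its iterations. Entries of `f`
from `m` on are those fixed by the enclosing loops. -/
theorem nest_spec {α : Type*} {n M : ℕ} {P : Cmd} (hP : P.safe = true)
    (hw : ∀ x, 100 ≤ x → P.writes x = false) {Inv : Core → List α → Prop}
    {Goal : (ℕ → ℕ) → List α → Prop} (h0 : ∀ c Q, Inv c Q → c.reg 0 = n)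
    (hset : ∀ c Q r v, 100 ≤ r → Inv c Q → Inv (c.setReg r v) Q)
    (hmono : ∀ f Q Q', Q <+: Q' → Goal f Q → Goal f Q')
    (hbody : ∀ c Q, Inv c Q → (∀ i < M, c.reg (100 + i) < n) →
      ∃ Q', Q <+: Q' ∧ Inv (P.eval c) Q' ∧ Goal (fun i => c.reg (100 + i)) Q')
    (m : ℕ) (c : Core) (Q : List α) (hc : Inv c Q)
    (hlt : ∀ i < M, m ≤ i → c.reg (100 + i) < n) :
    ∃ Q', Q <+: Q' ∧ Inv ((nest m P).eval c) Q' ∧ ∀ f : ℕ → ℕ, (∀ i < m, f i < n) →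
      (∀ i, m ≤ i → f i = c.reg (100 + i)) → Goal f Q' := by
  induction m generalizing c Q with
  | zero =>
    obtain ⟨Q', h1, h2, h3⟩ := hbody c Q hc fun i hi => hlt i hi (Nat.zero_le i)
    refine ⟨Q', h1, h2, fun f _ hf => ?_⟩
    rwa [funext fun i => hf i (Nat.zero_le i)]
  | succ m ih =>
    have key := Cmd.for_rule (c := c) (r := 100 + m) (P := nest m P) (nest_safe hP hw (m + 1))
      (fun k d => ∃ Q', Q <+: Q' ∧ Inv d Q' ∧ ∀ f : ℕ → ℕ, (∀ i < m + 1, f i < n) → f m < k →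
        (∀ i, m + 1 ≤ i → f i = c.reg (100 + i)) → Goal f Q')
      ⟨Q, List.prefix_rfl, hset _ _ _ _ (by omega) hc, by simp⟩ ?_
    · rw [h0 c Q hc] at key
      obtain ⟨Q', h1, h2, h3⟩ := key
      exact ⟨Q', h1, h2, fun f hf => h3 f hf (hf m (by omega))⟩
    · rintro k hk d hr hreg - ⟨Q', h1, h2, h3⟩
      rw [h0 c Q hc] at hk
      have hd : ∀ i, m + 1 ≤ i → d.reg (100 + i) = c.reg (100 + i) := by
        intro i hi
        refine hreg _ ?_
        rw [show Cmd.for_ (100 + m) (nest m P) = nest (m + 1) P from rfl, nest_writes]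
        simp only [hw (100 + i) (by omega), Bool.false_or, decide_eq_false_iff_not]
        omega
      obtain ⟨Q'', g1, g2, g3⟩ := ih d Q' h2 (fun i hi hmi => by
        rcases Nat.eq_or_lt_of_le hmi with rfl | hlt'
        · omega
        · rw [hd i hlt']
          exact hlt i hi hlt')
      refine ⟨Q'', h1.trans g1, hset _ _ _ _ (by omega) g2, fun f hf hfk hfi => ?_⟩
      rcases Nat.lt_succ_iff_lt_or_eq.1 hfk with h | h
      · exact hmono f _ _ g1 (h3 f hf h hfi)
      · refine g3 f (fun i hi => hf i (by omega)) fun i hi => ?_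
        rcases Nat.eq_or_lt_of_le hi with rfl | hlt'
        · rw [h, hr]
        · rw [hfi i hlt', hd i hlt']

/-- Put the vertices in the registers `100, …, 99 + j` into the set in bank `2`, provided that
register `31` contains one. -/
def addVertices : ℕ → Cmd
  | 0 => .skip
  | j + 1 => .seq (addVertices j) (.basic (.store 2 (100 + j) 31))

theorem addVertices_writes (j x : ℕ) : (addVertices j).writes x = false := by
  induction j with
  | zero => rfl
  | succ j ih => simp [addVertices, Cmd.writes, Instr.writes, ih]

theorem addVertices_stores (j : ℕ) {x : ℕ} (hx : x ≠ 2) : (addVertices j).stores x = false := by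
  induction j with
  | zero => rfl
  | succ j ih => simp [addVertices, Cmd.stores, Instr.stores, ih, hx]

theorem addVertices_silent (j : ℕ) : (addVertices j).silent = true := by
  induction j with
  | zero => rfl
  | succ j ih => simp [addVertices, Cmd.silent, Instr.silent, ih]

theorem addVertices_safe (j : ℕ) : (addVertices j).safe = true := by
  induction j with
  | zero => rfl
  | succ j ih => simp [addVertices, Cmd.safe, Instr.writes, Instr.noEmit, ih]

open Classical in
theorem addVertices_spec (j : ℕ) {c : Core} (h : c.reg 31 = 1) (a : ℕ) :
    ((addVertices j).eval c).mem 2 a = if ∃ i < j, c.reg (100 + i) = a then 1 else c.mem 2 a := by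
  induction j with
  | zero => simp [addVertices, Cmd.eval]
  | succ j ih =>
    simp only [addVertices, Cmd.eval, Instr.apply, Cmd.eval_reg (addVertices_writes j _), h,
      Core.setMem_mem, if_true, Function.update_apply, ih, Nat.lt_succ_iff_lt_or_eq, or_and_right,
      exists_or, exists_eq_left, eq_comm (a := a)]
    by_cases h1 : c.reg (100 + j) = a <;> simp [h1]

/-- Exchange the vertex in register `100 + m` for those in the registers `100, …, 99 + m` in the set
in bank `3`, and if the result is a target set, insert a minimal target set contained in it. -/
def attempt (m : ℕ) : Cmd :=
  .seq (copyBank 3 2) (.seq (.basic (.const 31 1)) (.seq (addVertices m) (.seq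
    (.basic (.const 31 0)) (.seq (.basic (.store 2 (100 + m) 31)) (.seq check (.seq
    (.basic (.const 32 0)) (.ite (.lt 32 21) (.seq minimise insert) .skip)))))))

/-- What is protected: register 0 (the size), 1 (the head of the queue), 3 (the number of sets
output), and the loop variables from 100 on. -/
theorem attempt_writes (m : ℕ) {x : ℕ} (hx : x ∉ Set.Icc 4 99 ∧ x ≠ 2) :
    (attempt m).writes x = false := by
  have : ∀ y ∈ Set.Icc 4 99, x ≠ y := fun y hy h => hx.1 (h ▸ hy)
  simp only [Set.mem_Icc] at this
  simp [attempt, Cmd.writes, Instr.writes, addVertices_writes, check, minimise, insert, copyBank,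
    round, allActive, visit, countNeighbours, walk, descend, enqueue, this, hx.2]

theorem attempt_stores (m : ℕ) {x : ℕ} (hx : x = 0 ∨ x = 3) : (attempt m).stores x = false := by
  rcases hx with rfl | rfl
  all_goals
    simp only [attempt, Cmd.stores, addVertices_stores m (x := 0) (by simp),
      addVertices_stores m (x := 3) (by simp)]
    rfl

theorem attempt_silent (m : ℕ) : (attempt m).silent = true := by
  simp only [attempt, Cmd.silent, addVertices_silent]
  rfl

theorem attempt_safe (m : ℕ) : (attempt m).safe = true := by
  simp only [attempt, Cmd.safe, addVertices_safe]
  rfl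

/-! ### Exploring all exchanges of one minimal target set. -/

section Expand

variable {n : ℕ}

/-- The data invariant: the instance is in bank `0`, and the queue `Q` consists of minimal target
sets. -/
structure Valid (G : SimpleGraph (Fin n)) (t : Fin n → ℕ) (c : Core) (Q : List (Finset (Fin n))) :
    Prop where
  size : c.reg 0 = n
  input : IsInput G t (c.mem 0)
  holds : Holds c Q
  minimal : ∀ S ∈ Q, IsMinimalTargetSet G t S

variable {G : SimpleGraph (Fin n)} {t : Fin n → ℕ}

theorem Valid.congr {c d : Core} {Q : List (Finset (Fin n))} (h : Valid G t c Q)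
    (hr : ∀ r ∈ [0, 2, 4, 5], d.reg r = c.reg r) (hm : ∀ b ∈ [0, 4, 5, 6, 7], d.mem b = c.mem b) :
    Valid G t d Q :=
  ⟨(hr 0 (by simp)).trans h.size, (hm 0 (by simp)).symm ▸ h.input,
    h.holds.congr (hr 2 (by simp)) (hr 4 (by simp)) (hr 5 (by simp)) fun b hb =>
      hm b (List.mem_cons_of_mem _ hb), h.minimal⟩

/-- The subset of `S` in the queue, whether new or inserted before, is what the closure hypothesis
of `mem_of_exchange_closed` asks for. -/
theorem minimise_insert_spec {c : Core} {Q : List (Finset (Fin n))} (h : Valid G t c Q)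
    {S : Finset (Fin n)} (hS : Represents (c.mem 2) S) (hT : IsTargetSet G t S) :
    ∃ Q', Q <+: Q' ∧ Valid G t ((Cmd.seq minimise insert).eval c) Q' ∧ ∃ T ∈ Q', T ⊆ S := by
  obtain ⟨T, h1, h2, h3⟩ := minimise_spec h.size h.input hS hT
  have hv : Valid G t (minimise.eval c) Q := by
    refine h.congr (fun r hr => Cmd.eval_reg ?_ _) (fun b hb => Cmd.eval_mem ?_ _)
    · fin_cases hr <;> rfl
    · fin_cases hb <;> rfl
  obtain ⟨Q', g1, g2, g3, g4⟩ := insert_spec hv.size h3 hv.holds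
  rw [Cmd.eval_seq]
  refine ⟨Q', g1, ⟨(Cmd.eval_reg rfl _).trans hv.size, ?_, g4, fun U hU => ?_⟩, T, g2, h1⟩
  · rw [Cmd.eval_mem rfl]
    exact hv.input
  · rcases g3 U hU with hU | rfl
    exacts [h.minimal U hU, h2]

open Classical in
theorem attempt_spec (m : ℕ) {c : Core} {Q : List (Finset (Fin n))} (h : Valid G t c Q)
    {S : Finset (Fin n)} (hS : Represents (c.mem 3) S) :
    ∃ Q', Q <+: Q' ∧ Valid G t ((attempt m).eval c) Q' ∧
      ∀ X : Finset (Fin n), (∀ v, v ∈ X ↔ (v ∈ S ∨ ∃ i < m, c.reg (100 + i) = v) ∧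
        c.reg (100 + m) ≠ v) → IsTargetSet G t X → ∃ T ∈ Q', T ⊆ X := by
  set P : Cmd := .seq (copyBank 3 2) (.seq (.basic (.const 31 1)) (.seq (addVertices m) (.seq
    (.basic (.const 31 0)) (.basic (.store 2 (100 + m) 31))))) with hP
  set X : Finset (Fin n) := Finset.univ.filter fun v : Fin n =>
    (v ∈ S ∨ ∃ i < m, c.reg (100 + i) = v) ∧ c.reg (100 + m) ≠ v with hX
  have hPr : ∀ r ∈ [0, 2, 4, 5], P.writes r = false := by
    intro r hr
    simp only [hP, Cmd.writes, addVertices_writes]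
    fin_cases hr <;> rfl
  have hPm : ∀ b ∈ [0, 4, 5, 6, 7], P.stores b = false := by
    intro b hb
    simp only [hP, Cmd.stores, addVertices_stores m (show b ≠ 2 by rintro rfl; simp at hb)]
    fin_cases hb <;> rfl
  have hrepr : Represents ((P.eval c).mem 2) X := by
    intro v
    have hcopy := copyBank_spec (a := 3) (b := 2) (by simp) c v (h.size ▸ v.2)
    have hr : ∀ i, ((copyBank 3 2).eval c).reg (100 + i) = c.reg (100 + i) := fun i =>
      Cmd.eval_reg (by simp [copyBank, Cmd.writes, Instr.writes]; omega) c
    have hadd := addVertices_spec m (c := ((copyBank 3 2).eval c).setReg 31 1) (by simp) v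
    have hne : ∀ i, 100 + i ≠ 31 := fun i => by omega
    simp only [Core.setReg_reg, Core.setReg_mem, hne, if_false, hr, hcopy, hS v] at hadd
    simp only [hP, Cmd.eval_seq, Cmd.eval_basic, Instr.apply, Core.setMem_mem, if_true,
      Core.setReg_mem, Core.setReg_reg, hne, if_false, Cmd.eval_reg (addVertices_writes m _), hr,
      Function.update_apply, hadd, hX, Finset.mem_filter, Finset.mem_univ, true_and]
    by_cases h1 : c.reg (100 + m) = v
    · simp [h1]
    · by_cases h2 : ∃ i < m, c.reg (100 + i) = v <;> by_cases h3 : v ∈ S <;>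
        simp [h1, h2, h3, Ne.symm h1]
  have hv : Valid G t (P.eval c) Q :=
    h.congr (fun r hr => Cmd.eval_reg (hPr r hr) _) (fun b hb => Cmd.eval_mem (hPm b hb) _)
  have hc := check_spec hv.size hv.input hrepr
  have c2 := Cmd.eval_mem (P := check) (x := 2) rfl (P.eval c)
  have hv' : Valid G t ((check.eval (P.eval c)).setReg 32 0) Q := by
    refine hv.congr (fun r hr => ?_) (fun b hb => Cmd.eval_mem ?_ _)
    · fin_cases hr <;> exact Cmd.eval_reg rfl _
    · fin_cases hb <;> rfl
  -- The commands preparing the exchanged set are regrouped into the single program `P`, which does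
  -- not change the evaluation.
  have e : (attempt m).eval c = (Cmd.ite (.lt 32 21) (.seq minimise insert) .skip).eval
      ((check.eval (P.eval c)).setReg 32 0) := rfl
  rw [e]
  have huniq : ∀ Y : Finset (Fin n), (∀ v, v ∈ Y ↔ (v ∈ S ∨ ∃ i < m, c.reg (100 + i) = v) ∧
      c.reg (100 + m) ≠ v) → Y = X := by
    intro Y hY
    ext v
    rw [hY v, hX]
    simp
  generalize check.eval (P.eval c) = d at *
  by_cases hT : IsTargetSet G t X
  · obtain ⟨Q', h1, h2, h3⟩ := minimise_insert_spec hv' (S := X) (by simpa [c2] using hrepr) hT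
    rw [Cmd.eval, if_pos (by simp [hc, hT])]
    exact ⟨Q', h1, h2, fun Y hY _ => huniq Y hY ▸ h3⟩
  · rw [Cmd.eval, if_neg (by simp [hc, hT])]
    exact ⟨Q, List.prefix_rfl, hv', fun Y hY hY' => absurd (huniq Y hY ▸ hY') hT⟩

/-- Process the set in bank `3`: try all exchanges of one vertex for at most `m` vertices. -/
def expand (m : ℕ) : Cmd := nest (m + 1) (attempt m)

theorem expand_safe (m : ℕ) : (expand m).safe = true :=
  nest_safe (attempt_safe m) (fun x hx => attempt_writes m
    ⟨fun h => by have := h.2; omega, by omega⟩) _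

theorem expand_silent (m : ℕ) : (expand m).silent = true :=
  (nest_silent _ _).trans (attempt_silent m)

theorem expand_writes (m : ℕ) {x : ℕ} (hx : x ∈ [0, 1, 3]) : (expand m).writes x = false := by
  rw [expand, nest_writes, attempt_writes]
  · fin_cases hx <;> simp
  · fin_cases hx <;> simp

open Classical in
theorem expand_spec (m : ℕ) {c : Core} {Q : List (Finset (Fin n))} (h : Valid G t c Q)
    {S : Finset (Fin n)} (hS : Represents (c.mem 3) S) :
    ∃ Q', Q <+: Q' ∧ Valid G t ((expand m).eval c) Q' ∧
      ∀ v, ∀ K : Finset (Fin n), K.card ≤ m → IsTargetSet G t ((S ∪ K).erase v) →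
        ∃ T ∈ Q', T ⊆ (S ∪ K).erase v := by
  obtain ⟨Q', h1, h2, h3⟩ := nest_spec (n := n) (M := m + 1) (P := attempt m) (attempt_safe m)
    (fun x hx => attempt_writes m ⟨fun h => by have := h.2; omega, by omega⟩)
    (Inv := fun c Q => Valid G t c Q ∧ Represents (c.mem 3) S)
    (Goal := fun f Q => ∀ X : Finset (Fin n), (∀ v : Fin n, v ∈ X ↔
      (v ∈ S ∨ ∃ i < m, f i = v) ∧ f m ≠ v) → IsTargetSet G t X → ∃ T ∈ Q, T ⊆ X)
    (fun c Q h => h.1.size)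
    (fun c Q r v hr h => ⟨h.1.congr (fun x hx => by
      have : x ≠ r := by fin_cases hx <;> omega
      simp [this]) (fun b _ => rfl), h.2⟩)
    (fun f Q Q' hle hG X hX hT => by
      obtain ⟨T, h1, h2⟩ := hG X hX hT
      exact ⟨T, hle.subset h1, h2⟩)
    (fun c Q h _ => by
      obtain ⟨Q', h1, h2, h3⟩ := attempt_spec m h.1 h.2
      refine ⟨Q', h1, ⟨h2, ?_⟩, h3⟩
      rw [Cmd.eval_mem (attempt_stores m (Or.inr rfl))]
      exact h.2)
    (m + 1) c Q ⟨h, hS⟩ (fun i h1 h2 => by omega)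
  refine ⟨Q', h1, h2.1, fun v K hK hT => ?_⟩
  -- If `K` has fewer than `m` elements, the tuple is padded with `v`, which is harmless because `v`
  -- is removed after the additions.
  set f : ℕ → ℕ := fun i =>
    if i < m then (K.toList.getD i v : Fin n) else if i = m then v else c.reg (100 + i) with hf
  refine h3 f (fun i hi => ?_) (fun i hi => ?_) _ (fun u => ?_) hT
  · simp only [hf]
    split_ifs
    exacts [Fin.is_lt _, v.2, by omega]
  · simp only [hf]
    rw [if_neg (by omega), if_neg (by omega)]
  · have hfm : f m = v := by simp [hf]
    have hfi : (∃ i < m, f i = u) → u ∈ K ∨ v = u := by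
      rintro ⟨i, hi, e⟩
      simp only [hf, if_pos hi, Fin.val_inj] at e
      rcases Nat.lt_or_ge i K.toList.length with hlt | hge
      · rw [List.getD_eq_getElem _ _ hlt] at e
        exact Or.inl (e ▸ Finset.mem_toList.1 (List.getElem_mem hlt))
      · rw [List.getD_eq_default _ _ hge] at e
        exact Or.inr e
    have hfK : u ∈ K → ∃ i < m, f i = u := by
      intro hu
      obtain ⟨i, hi, e⟩ := List.mem_iff_getElem.1 (Finset.mem_toList.2 hu)
      have him : i < m := by
        rw [Finset.length_toList] at hi
        omega
      exact ⟨i, him, by simp only [hf, if_pos him, List.getD_eq_getElem _ _ hi, e]⟩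
    rw [hfm, Finset.mem_erase, Finset.mem_union, ne_comm, ne_eq, ne_eq, Fin.val_inj, and_comm]
    exact and_congr_left fun hne =>
      or_congr_right ⟨hfK, fun h => (hfi h).resolve_right hne⟩

end Expand

end TargetSet

namespace TargetSet

/-! ### The enumeration algorithm -/

section Main

variable {n : ℕ} {G : SimpleGraph (Fin n)} {t : Fin n → ℕ}

/-- Move the next set of the queue to bank `3`, and write it. -/
def dequeue : Cmd :=
  .seq (.for_ 10 (.seq (.basic (.load 11 4 1)) (.seq (.basic (.store 3 10 11))
    (.seq (.basic (.write 11)) (.basic (.incr 1)))))) (.basic (.incr 3))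

theorem dequeue_spec {c : Core} {Q : List (Finset (Fin n))} (h : Valid G t c Q) {j : ℕ}
    (hj : j < Q.length) (h1 : c.reg 1 = j * n) (hbuf : c.buf = []) :
    Valid G t (dequeue.eval c) Q ∧ Represents ((dequeue.eval c).mem 3) Q[j] ∧
      (dequeue.eval c).buf = charVector Q[j] ∧ (dequeue.eval c).reg 1 = (j + 1) * n ∧
      (dequeue.eval c).reg 3 = c.reg 3 + 1 := by
  refine ⟨h.congr (fun r hr => Cmd.eval_reg ?_ _) (fun b hb => Cmd.eval_mem ?_ _), ?_⟩
  · fin_cases hr <;> rfl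
  · fin_cases hb <;> rfl
  have hlen : (charVector Q[j]).length = n := by simp [charVector]
  have key := Cmd.for_rule (c := c) (r := 10) (P := .seq (.basic (.load 11 4 1))
    (.seq (.basic (.store 3 10 11)) (.seq (.basic (.write 11)) (.basic (.incr 1))))) rfl
    (fun k d => (∀ i : Fin n, (i : ℕ) < k → d.mem 3 i = if i ∈ Q[j] then 1 else 0) ∧
      d.buf = (charVector Q[j]).take k ∧ d.reg 1 = j * n + k)
    ⟨by simp, by simpa using hbuf, by simpa using h1⟩ ?_
  · rw [h.size] at key
    obtain ⟨k1, k2, k3⟩ := key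
    rw [List.take_of_length_le hlen.le] at k2
    simp only [dequeue, Cmd.eval_seq, Cmd.eval_basic, Instr.apply, Core.setReg_mem, Core.setReg_buf,
      Core.setReg_reg]
    refine ⟨fun i => k1 i i.2, k2, by simpa [Nat.add_mul] using k3, ?_⟩
    rw [if_true, Cmd.eval_reg rfl]
  · rintro k hk d hr - hm ⟨k1, k2, k3⟩
    rw [h.size] at hk
    have m4 : d.mem 4 (j * n + k) = _ :=
      (congrFun (hm 4 rfl) _).trans (h.holds.queue j hj ⟨k, hk⟩)
    refine ⟨fun i hi => ?_, ?_, ?_⟩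
    · by_cases e : (i : ℕ) = k
      · obtain rfl : i = ⟨k, hk⟩ := Fin.ext e
        simp [Cmd.eval, Instr.apply, hr, k3, m4]
      · simpa [Cmd.eval, Instr.apply, hr, e] using k1 i (by omega)
    · rw [List.take_succ_eq_append_getElem (hlen.symm ▸ hk)]
      simp [Cmd.eval, Instr.apply, k3, m4, k2, charVector]
    · simp [Cmd.eval, Instr.apply, k3, Nat.add_assoc]

/-- Put a first minimal target set into the queue. -/
def start : Cmd :=
  .seq (.for_ 10 (.seq (.basic (.const 11 1)) (.basic (.store 2 10 11)))) (.seq minimise insert)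

/-- The whole vertex set is a target set; shrinking it provides the nonempty family that the
reachability argument starts from. -/
theorem start_spec {c : Core} (h : Valid G t c []) :
    ∃ Q, Q ≠ [] ∧ Valid G t (start.eval c) Q := by
  have key := Cmd.for_rule (c := c) (r := 10) (P := .seq (.basic (.const 11 1))
    (.basic (.store 2 10 11))) rfl (fun k d => ∀ i < k, d.mem 2 i = 1) (by simp) ?_
  · rw [start, Cmd.eval_seq]
    have hv : Valid G t ((Cmd.for_ 10 (.seq (.basic (.const 11 1))
        (.basic (.store 2 10 11)))).eval c) [] := by
      refine h.congr (fun r hr => Cmd.eval_reg ?_ _) (fun b hb => Cmd.eval_mem ?_ _)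
      · fin_cases hr <;> rfl
      · fin_cases hb <;> rfl
    obtain ⟨Q, -, h2, T, hT, -⟩ := minimise_insert_spec hv (S := Finset.univ)
      (fun i => by simpa using key i (h.size ▸ i.2)) isTargetSet_univ
    exact ⟨Q, List.ne_nil_of_mem hT, h2⟩
  · rintro k - d hr - - ih i hi
    by_cases e : i = k
    · simp [Cmd.eval, Instr.apply, hr, e]
    · simpa [Cmd.eval, Instr.apply, hr, e] using ih i (by omega)

/-- The main loop: output the sets in the queue, and insert those found by exchanges. -/
def mainLoop (m : ℕ) : Prog :=
  .loop (.lt 3 4) (.seq dequeue.toProg (.seq (.basic .emit) (expand m).toProg))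

/-- The enumeration algorithm for thresholds at most `m`. -/
def enumerate (m : ℕ) : Prog :=
  .seq (.basic (.load 0 0 1)) (.seq start.toProg (mainLoop m))

open Classical in
/-- The sets in `R` have been processed: the results of exchanging a vertex of a member of `R` are
represented in `Q`. -/
def Processed (G : SimpleGraph (Fin n)) (t : Fin n → ℕ) (m : ℕ) (R Q : List (Finset (Fin n))) :
    Prop :=
  ∀ S ∈ R, ∀ v, ∀ K : Finset (Fin n), K.card ≤ m → IsTargetSet G t ((S ∪ K).erase v) →
    ∃ T ∈ Q, T ⊆ (S ∪ K).erase v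

/-- The invariant of the main loop, when `j` sets have been output, for a delay of at most `d`. -/
structure LoopInv (G : SimpleGraph (Fin n)) (t : Fin n → ℕ) (m d e : ℕ) (s : State)
    (Q : List (Finset (Fin n))) (j : ℕ) : Prop where
  valid : Valid G t s.core Q
  ne_nil : Q ≠ []
  le_length : j ≤ Q.length
  head : s.reg 1 = j * n
  count : s.reg 3 = j
  buf : s.buf = []
  out : s.out.map Prod.fst = (Q.take j).map charVector
  processed : Processed G t m (Q.take j) Q
  delay : List.IsChain (fun T T' => T' ≤ T + d) (0 :: s.out.map Prod.snd)
  time : ∀ T ∈ (0 :: s.out.map Prod.snd).getLast?, s.time ≤ T + e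

/-- The loop terminates because the queue never repeats a subset of `Fin n`; the induction is on the
number of subsets minus `j`. At the head of the loop at most `e` steps have passed since the last
output (or the start). The next output costs a test, `dequeue` and `emit`, whence the summand 2 in
`hd`. On exit all of the queue has been processed. -/
theorem mainLoop_spec {m d e : ℕ} (he : (expand m).cost.eval n ≤ e)
    (hd : e + dequeue.cost.eval n + 2 ≤ d) {s : State} {Q : List (Finset (Fin n))} {j : ℕ}
    (h : LoopInv G t m d e s Q j) :
    ∃ s', Exec (mainLoop m) s s' ∧ ∃ Q : List (Finset (Fin n)), Q ≠ [] ∧ Q.Nodup ∧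
      (∀ S ∈ Q, IsMinimalTargetSet G t S) ∧ Processed G t m Q Q ∧
      s'.out.map Prod.fst = Q.map charVector ∧
      List.IsChain (fun T T' => T' ≤ T + d) (0 :: (s'.out.map Prod.snd ++ [s'.time])) := by
  induction hk : Fintype.card (Finset (Fin n)) - j using Nat.strong_induction_on
    generalizing s Q j with
  | _ k ih =>
  have hcard := h.valid.holds.nodup.length_le_card
  have htest : (Test.lt 3 4).Holds s ↔ j < Q.length := by
    have := h.valid.holds.count
    rw [State.core_reg] at this
    rw [Test.Holds, h.count, this]
  rcases Nat.lt_or_eq_of_le h.le_length with hj | rfl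
  · have hn : s.reg 0 = n := h.valid.size
    obtain ⟨s₁, e₁, c₁, o₁, t₁⟩ := Cmd.exec (P := dequeue) rfl s.tick
    rw [State.core_tick] at c₁
    obtain ⟨v₁, r₁, b₁, p₁, q₁⟩ := dequeue_spec h.valid hj h.head h.buf
    set s₂ := Instr.emit.run s₁ with hs₂
    have v₂ : Valid G t s₂.core Q := v₁.congr (by simp [← c₁, hs₂, Instr.run])
      (by simp [← c₁, hs₂, Instr.run])
    have r₂ : Represents (s₂.core.mem 3) Q[j] := by
      rw [← c₁] at r₁
      exact r₁
    obtain ⟨s₃, e₃, c₃, o₃, t₃⟩ := Cmd.exec (expand_safe m) s₂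
    obtain ⟨Q', g1, g2, g3⟩ := expand_spec m v₂ r₂
    rw [← c₃] at g2
    have hn₂ : s₂.reg 0 = n := v₂.size
    have hout : s₃.out = s.out ++ [(charVector Q[j], s₁.time + 1)] := by
      rw [o₃, hs₂, Instr.run, o₁, ← b₁, ← c₁]
      rfl
    have htake : Q'.take (j + 1) = Q.take j ++ [Q[j]] := by
      obtain ⟨R, rfl⟩ := g1
      rw [List.take_append_of_le_length hj, List.take_succ_eq_append_getElem hj]
    have hle := g1.length_le
    simp only [State.tick, hn] at t₁
    rw [hn₂] at t₃
    have ht₂ : s₂.time = s₁.time + 1 := Instr.time_run _ _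
    obtain ⟨s', e', hs'⟩ := ih (Fintype.card (Finset (Fin n)) - (j + 1)) (by omega) (s := s₃)
      (Q := Q') (j := j + 1) {
        valid := g2
        ne_nil := fun h0 => h.ne_nil (List.prefix_nil.1 (h0 ▸ g1))
        le_length := by omega
        head := by
          rw [← State.core_reg, c₃, Cmd.eval_reg (expand_writes m (by simp)), ← p₁, ← c₁]
          rfl
        count := by
          rw [← State.core_reg, c₃, Cmd.eval_reg (expand_writes m (by simp))]
          rw [← c₁] at q₁
          exact q₁.trans (congrArg (· + 1) h.count)
        buf := by
          rw [← State.core_buf, c₃, Cmd.eval_buf (expand_silent m)]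
          rfl
        out := by
          rw [hout, htake, List.map_append, List.map_append, h.out]
          rfl
        processed := by
          rw [htake]
          intro S hS v K hK hT
          rcases List.mem_append.1 hS with hS | hS
          · obtain ⟨T, hT1, hT2⟩ := h.processed S hS v K hK hT
            exact ⟨T, g1.subset hT1, hT2⟩
          · rw [List.mem_singleton.1 hS] at hT ⊢
            exact g3 v K hK hT
        delay := by
          rw [hout, List.map_append, ← List.cons_append, List.isChain_append]
          refine ⟨h.delay, by simp, fun T hT T' hT' => ?_⟩
          have := h.time T hT
          simp only [List.map_cons, List.map_nil, List.head?_cons, Option.mem_some_iff] at hT'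
          omega
        time := by
          rw [hout, List.map_append, ← List.cons_append]
          intro T hT
          simp only [List.map_cons, List.map_nil, List.getLast?_concat, Option.mem_some_iff] at hT
          omega } rfl
    exact ⟨s', .loopTrue (htest.2 hj) (.seq e₁ (.seq (.basic _ _) e₃)) e', hs'⟩
  · refine ⟨s.tick, .loopFalse (by simp [htest]), Q, h.ne_nil, h.valid.holds.nodup,
      h.valid.minimal, ?_, ?_, ?_⟩
    · simpa using h.processed
    · exact h.out.trans (by rw [List.take_length])
    · rw [← List.cons_append, List.isChain_append]
      refine ⟨h.delay, by simp, fun T hT T' hT' => ?_⟩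
      have := h.time T hT
      simp only [State.tick, List.head?_cons, Option.mem_some_iff] at hT'
      omega

/-- Zeroed memory already encodes the empty queue and the trie consisting of an unmarked root, since
0 stands for a missing child. -/
theorem holds_initial {x : ℕ → ℕ} {r : ℕ} :
    Holds (n := n) ⟨Function.update (fun _ => 0) 0 r, fun b a => if b = 0 then x a else 0, []⟩ [] := by
  refine ⟨⟨fun _ => [], ?_⟩, by simp, by simp, by simp, by simp⟩
  constructor <;> simp

/-- Coefficients are natural numbers. This passes from costs in terms of n to a delay in terms of
the input length. -/
theorem eval_le_eval (p : Polynomial ℕ) {a b : ℕ} (h : a ≤ b) : p.eval a ≤ p.eval b := by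
  rw [Polynomial.eval_eq_sum, Polynomial.eval_eq_sum]
  exact Finset.sum_le_sum fun i _ => Nat.mul_le_mul_left _ (Nat.pow_le_pow_left h i)

theorem valid_initial (G : SimpleGraph (Fin n)) (t : Fin n → ℕ) :
    Valid G t ((Instr.load 0 0 1).run (State.initial (encodeInstance G t))).core [] := by
  refine ⟨?_, ?_, ?_, by simp⟩
  · simp [Instr.run, State.setReg, State.tick, State.initial, encodeInstance]
  · simpa [Instr.run, State.setReg, State.tick, State.initial] using isInput_encodeInstance G t
  · exact holds_initial

end Main

end TargetSet

theorem mainTheorem12 (c : ℕ) :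
    ∃ (P : RAM.Prog) (p : Polynomial ℕ),
      ∀ (n : ℕ) (G : SimpleGraph (Fin n)) (t : Fin n → ℕ), (∀ v, t v ≤ c) →
        RAM.GeneratesWithDelay P (TargetSet.encodeInstance G t)
          {w | ∃ S : Finset (Fin n), TargetSet.IsMinimalTargetSet G t S ∧
            w = TargetSet.charVector S}
          (p.eval (TargetSet.encodeInstance G t).length) := by
  classical
  refine ⟨TargetSet.enumerate c, 1 + TargetSet.start.cost + (TargetSet.expand c).cost +
    TargetSet.dequeue.cost + 2, fun n G t ht => ?_⟩
  set d := Polynomial.eval (TargetSet.encodeInstance G t).length (1 + TargetSet.start.cost +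
    (TargetSet.expand c).cost + TargetSet.dequeue.cost + 2) with hd
  have hN : n ≤ (TargetSet.encodeInstance G t).length := by
    simp only [TargetSet.encodeInstance, List.length_cons, List.length_append, List.length_ofFn]
    omega
  have hle := TargetSet.eval_le_eval (1 + TargetSet.start.cost +
    (TargetSet.expand c).cost + TargetSet.dequeue.cost + 2) hN
  rw [← hd] at hle
  simp only [Polynomial.eval_add, Polynomial.eval_one, Polynomial.eval_ofNat] at hle
  clear_value d
  set s₀ := (Instr.load 0 0 1).run (State.initial (TargetSet.encodeInstance G t)) with hs₀
  have v₀ := TargetSet.valid_initial G t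
  obtain ⟨s₁, e₁, c₁, o₁, t₁⟩ := Cmd.exec (P := TargetSet.start) rfl s₀
  obtain ⟨Q, hQ, v₁⟩ := TargetSet.start_spec v₀
  rw [← hs₀, ← c₁] at v₁
  have hn : s₀.reg 0 = n := v₀.size
  rw [hn] at t₁
  have hs₁ : ∀ r ∈ [1, 3], s₁.reg r = 0 := by
    intro r hr
    rw [← State.core_reg, c₁, Cmd.eval_reg (by fin_cases hr <;> rfl)]
    fin_cases hr <;> rfl
  have ho₁ : s₁.out = [] := o₁
  obtain ⟨s', e', Q', h1, h2, h3, h4, h5, h6⟩ := TargetSet.mainLoop_spec (m := c) (d := d)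
    -- This `e` covers both ways of reaching the head of the loop: the initial load followed by
    -- `start`, and `expand` after an output.
    (e := 1 + TargetSet.start.cost.eval n + (TargetSet.expand c).cost.eval n) (G := G) (t := t)
    (by omega) (by omega) (s := s₁) (Q := Q) (j := 0) {
      valid := v₁
      ne_nil := hQ
      le_length := Nat.zero_le _
      head := by rw [hs₁ 1 (by simp), Nat.zero_mul]
      count := hs₁ 3 (by simp)
      buf := by
        rw [← State.core_buf, c₁, Cmd.eval_buf rfl]
        rfl
      out := by simp [ho₁]
      processed := by simp [TargetSet.Processed]
      delay := by simp [ho₁]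
      time := by
        have : s₀.time = 1 := rfl
        simp only [ho₁, List.map_nil, List.getLast?_singleton, Option.mem_some_iff]
        omega }
  refine ⟨s', .seq (.basic _ _) (.seq e₁ e'), ?_, fun w => ?_, h6⟩
  · rw [h5]
    exact h2.map TargetSet.charVector_injective
  · rw [h5, List.mem_map]
    constructor
    · rintro ⟨S, hS, rfl⟩
      exact ⟨S, h3 S hS, rfl⟩
    · rintro ⟨S, hS, rfl⟩
      refine ⟨S, ?_, rfl⟩
      -- Completeness: the final queue is nonempty, consists of minimal target sets and is closed
      -- under exchanges.
      exact TargetSet.mem_of_exchange_closed (F := {T | T ∈ Q'}) ht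
        (List.exists_mem_of_ne_nil _ h1) h3 h4 hS
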